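/- Let $X\subseteq\mathbb{R}^n$ and $Y\subseteq\mathbb{R}^p$ be closed and convex, let $f:\mathbb{R}^n\times\mathbb{R}^p\to\mathbb{R}$, $r_1:\mathbb{R}^n\to\mathbb{R}$, $r_2:\mathbb{R}^p\to\mathbb{R}$, and put $h(x,y)=f(x,y)+r_1(x)-r_2(y)$. Write $\partial$ for the Clarke subdifferential, $\mathcal{N}_C(z)$ for the normal cone of a closed convex set $C$ at $z$ (empty if $z\notin C$), and $\|\cdot\|$ for the Euclidean norm. Assume: (a) $f$ is $C^1$ and $\nabla f$ is $L_f$-Lipschitz on $\mathbb{R}^n\times\mathbb{R}^p$; $\nabla^2_{yy}f(x,y)$ exists for all $(x,y)\in X\times Y$; there is $\mu>0$ such that for every $x\in X$ the function $f(x,\cdot)$ is $\mu$-strongly concave on $Y$; (b) $r_1$ is locally Lipschitz and path-differentiable (it is the potential of a conservative field); $r_2$ is locally Lipschitz and convex; (c) $h$ takes only finitely many values on $\mathcal{C}_h$, the set of first-order minimax points of $\min_{x\in X}\max_{y\in Y}h(x,y)$, i.e. of all $(x,y)\in X\times Y$ with $0\in\nabla_xf(x,y)+\partial r_1(x)+\mathcal{N}_X(x)$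 and $0\in-\nabla_yf(x,y)+\partial r_2(y)+\mathcal{N}_Y(y)$; (d) $\eta>0$, $\alpha\ge\max\{1,\frac{2}{\eta\mu}\}$ and $\theta\ge\frac{\alpha\eta L_f^2}{\mu}$; $(\eta_{x,k})$ and $(\eta_{y,k})$ are positive sequences with $\sum_k\eta_{x,k}=\sum_k\eta_{y,k}=+\infty$, $\sup_k\eta_{y,k}\le\eta$ and $\lim_k\eta_{y,k}/\eta_{x,k}=\theta$; (e) for every $\alpha'\ge\max\{1,\frac{2}{\eta\mu}\}$ the function $\Gamma_{(\eta,\alpha')}$ is coercive over $X\times Y$, where $$\Gamma_{(\eta,\alpha)}(x,y)=\alpha\Psi_\eta(x,y)-(\alpha-1)f(x,y)+r_1(x)+(\alpha-1)r_2(y),$$ $$\Psi_\eta(x,y)=\max_{v\in Y}\; f(x,y)+\langle\nabla_yf(x,y),v-y\rangle-r_2(v)-\tfrac1{2\eta}\|v-y\|^2 .$$ Let $T_{y,\eta}(x,y)$ be the maximizer in the definition of $\Psi_\eta(x,y)$, let $R_{y,\eta}(x,y)=\frac1\eta(T_{y,\eta}(x,y)-y)$ and $\kappa(x,y)=2\sup\{\|l+\nabla_xf(x,y)\|:l\in\partial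 r_1(x)\}$, and let $$H(x,y)=\Big(\partial r_1(x)+\nabla_xf(x,y)+\{\nu\in\mathcal{N}_X(x):\|\nu\|\le\kappa(x,y)\}\Big)\times\{-\theta R_{y,\eta}(x,y)\}.$$ Consider, on the state space $X\times Y$, the differential inclusion $\big(\frac{dx}{dt},\frac{dy}{dt}\big)\in-H(x,y)$ associated with the subgradient descent-ascent method. A solution is a curve $\gamma:[0,\infty)\to\mathbb{R}^n\times\mathbb{R}^p$ that is absolutely continuous on bounded intervals and satisfies $\dot\gamma(t)\in-H(\gamma(t))$ for almost every $t\ge0$. Then, on $X\times Y$, $H$ is locally bounded, has nonempty convex values, and has closed graph; and $\Gamma_{(\eta,\alpha)}$ is a Lyapunov function for this differential inclusion with stable set $\mathcal{C}_h$. That is, $\mathcal{C}_h\subseteq X\times Y$ is closed, $\Gamma_{(\eta,\alpha)}$ is continuous on $\mathbb{R}^n\times\mathbb{R}^p$, and: (i) for every solution $\gamma$ with $\gamma(0)\in(X\times Y)\setminus\mathcal{C}_h$, $\Gamma_{(\eta,\alpha)}(\gamma(t))<\Gamma_{(\eta,\alpha)}(\gamma(0))$ for all $t>0$; (ii) for every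 solution $\gamma$ with $\gamma(0)\in\mathcal{C}_h$, $\Gamma_{(\eta,\alpha)}(\gamma(t))\le\Gamma_{(\eta,\alpha)}(\gamma(0))$ for all $t\ge0$. -/

import Mathlib

open Set Filter Topology MeasureTheory

namespace MinimaxFlow

noncomputable section

section General

variable {V : Type*} [NormedAddCommGroup V]

/-- A set-valued map `D` is locally bounded on `S`: every point of `S` has a neighbourhood in `S`
on which the values of `D` stay in one bounded set. -/
def LocallyBoundedOn {W : Type*} [NormedAddCommGroup W] (S : Set V) (D : V → Set W) : Prop :=
  ∀ z ∈ S, ∃ U ∈ 𝓝[S] z, Bornology.IsBounded (⋃ u ∈ U, D u)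

/-- The standing requirements on the right-hand side of a differential inclusion with state
space `S`: on `S` it is locally bounded, has nonempty convex values, and has closed graph. -/
structure IsAdmissibleField [NormedSpace ℝ V] (S : Set V) (H : V → Set V) : Prop where
  locallyBounded : LocallyBoundedOn S H
  nonempty : ∀ z ∈ S, (H z).Nonempty
  convex : ∀ z ∈ S, Convex ℝ (H z)
  closedGraph : IsClosed {q : V × V | q.1 ∈ S ∧ q.2 ∈ H q.1}

/-- `γ` (restricted to `[0, ∞)`) is a solution of `dz/dt ∈ -H(z)`: it is absolutely continuous on
every `[0, T]`, and at almost every `t > 0` it has a derivative that lies in `-H (γ t)`. -/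
def IsSolution [NormedSpace ℝ V] (H : V → Set V) (γ : ℝ → V) : Prop :=
  (∀ T : ℝ, 0 < T → AbsolutelyContinuousOnInterval γ 0 T) ∧
    ∀ᵐ t ∂(volume.restrict (Ioi (0 : ℝ))), ∃ v : V, HasDerivAt γ v t ∧ -v ∈ H (γ t)

/-- `Ψ` is a Lyapunov function, with stable set `A`, for the differential inclusion
`dz/dt ∈ -H(z)` considered on the state space `S`. -/
structure IsLyapunovFunction [NormedSpace ℝ V] (S : Set V) (H : V → Set V) (A : Set V)
    (Ψ : V → ℝ) : Prop where
  subset_state : A ⊆ S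
  isClosed_stable : IsClosed A
  continuous : Continuous Ψ
  strict_decrease : ∀ γ : ℝ → V, IsSolution H γ → γ 0 ∈ S → γ 0 ∉ A →
    ∀ t : ℝ, 0 < t → Ψ (γ t) < Ψ (γ 0)
  nonincrease : ∀ γ : ℝ → V, IsSolution H γ → γ 0 ∈ A →
    ∀ t : ℝ, 0 ≤ t → Ψ (γ t) ≤ Ψ (γ 0)

end General

section Nonsmooth

variable {E : Type*} [NormedAddCommGroup E] [InnerProductSpace ℝ E]

/-- The Clarke subdifferential of a locally Lipschitz function: the convex hull of all limits of
gradients taken along sequences of points of differentiability converging to `x`. -/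
def clarkeSubdiff [CompleteSpace E] (r : E → ℝ) (x : E) : Set E :=
  convexHull ℝ {g : E | ∃ z : ℕ → E, (∀ k, DifferentiableAt ℝ r (z k)) ∧
    Tendsto z atTop (𝓝 x) ∧ Tendsto (fun k => gradient r (z k)) atTop (𝓝 g)}

/-- The normal cone of a convex set `C` at `x`; it is empty when `x ∉ C`. -/
def normalCone (C : Set E) (x : E) : Set E :=
  {ν : E | x ∈ C ∧ ∀ x' ∈ C, inner ℝ ν (x' - x) ≤ 0}

/-- `D` is a conservative field with potential `r`: it has nonempty compact values and closed
graph, is locally bounded, and `r` obeys the chain rule with respect to `D` along every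
absolutely continuous curve, at almost every time. -/
structure IsConservativeFieldFor (D : E → Set E) (r : E → ℝ) : Prop where
  nonempty : ∀ x, (D x).Nonempty
  compact : ∀ x, IsCompact (D x)
  closedGraph : IsClosed {q : E × E | q.2 ∈ D q.1}
  locallyBounded : LocallyBoundedOn univ D
  chainRule : ∀ (a b : ℝ) (γ : ℝ → E), a < b → AbsolutelyContinuousOnInterval γ a b →
    ∀ᵐ t ∂(volume.restrict (Icc a b)), ∃ v : E, HasDerivAt γ v t ∧
      ∀ d ∈ D (γ t), HasDerivAt (fun s => r (γ s)) (inner ℝ d v) t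

/-- `r` is path-differentiable: it is locally Lipschitz and the potential of some
conservative field. -/
def PathDifferentiable (r : E → ℝ) : Prop :=
  LocallyLipschitz r ∧ ∃ D : E → Set E, IsConservativeFieldFor D r

end Nonsmooth

section Minimax

variable {E F : Type*} [NormedAddCommGroup E] [InnerProductSpace ℝ E] [CompleteSpace E]
  [NormedAddCommGroup F] [InnerProductSpace ℝ F] [CompleteSpace F]

/-- The partial gradient in the first variable. -/
def gradX (f : E → F → ℝ) (x : E) (y : F) : E := gradient (fun x' => f x' y) x

/-- The partial gradient in the second variable. -/
def gradY (f : E → F → ℝ) (x : E) (y : F) : F := gradient (fun y' => f x y') y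

/-- The objective of the proximal subproblem in the variable `v`. -/
def proxObjective (f : E → F → ℝ) (r₂ : F → ℝ) (η : ℝ) (x : E) (y v : F) : ℝ :=
  f x y + inner ℝ (gradY f x y) (v - y) - r₂ v - 1 / (2 * η) * ‖v - y‖ ^ 2

/-- The set `argmax` over `v ∈ Y` of the proximal objective (a single point when `η > 0`, `r₂` is
continuous and convex, and `Y` is nonempty, closed and convex). -/
def proxArgmax (Y : Set F) (f : E → F → ℝ) (r₂ : F → ℝ) (η : ℝ) (x : E) (y : F) : Set F :=
  {v : F | v ∈ Y ∧ IsMaxOn (proxObjective f r₂ η x y) Y v}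

/-- The residual `R = (T - y) / η`, where `T` is the maximizer of the proximal objective; written
as a set since `T` is an `argmax`. -/
def proxResidual (Y : Set F) (f : E → F → ℝ) (r₂ : F → ℝ) (η : ℝ) (x : E) (y : F) : Set F :=
  (fun v => η⁻¹ • (v - y)) '' proxArgmax Y f r₂ η x y

/-- The partial forward-backward envelope. -/
def envelope (Y : Set F) (f : E → F → ℝ) (r₂ : F → ℝ) (η : ℝ) (x : E) (y : F) : ℝ :=
  sSup (proxObjective f r₂ η x y '' Y)

/-- The penalty function `Γ` with parameters `η` and `α`. -/
def penalty (Y : Set F) (f : E → F → ℝ) (r₁ : E → ℝ) (r₂ : F → ℝ) (η α : ℝ) (z : E × F) : ℝ :=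
  α * envelope Y f r₂ η z.1 z.2 - (α - 1) * f z.1 z.2 + r₁ z.1 + (α - 1) * r₂ z.2

/-- The minimax objective `h(x, y) = f(x, y) + r₁(x) - r₂(y)`. -/
def objective (f : E → F → ℝ) (r₁ : E → ℝ) (r₂ : F → ℝ) (z : E × F) : ℝ :=
  f z.1 z.2 + r₁ z.1 - r₂ z.2

/-- The first-order minimax points of `min_{x ∈ X} max_{y ∈ Y} f(x, y) + r₁(x) - r₂(y)`. -/
def firstOrderMinimaxPoints (X : Set E) (Y : Set F) (f : E → F → ℝ) (r₁ : E → ℝ) (r₂ : F → ℝ) :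
    Set (E × F) :=
  {z : E × F | z.1 ∈ X ∧ z.2 ∈ Y ∧
    (∃ l ∈ clarkeSubdiff r₁ z.1, ∃ ν ∈ normalCone X z.1, 0 = gradX f z.1 z.2 + l + ν) ∧
    (∃ d ∈ clarkeSubdiff r₂ z.2, ∃ ν ∈ normalCone Y z.2, 0 = -gradY f z.1 z.2 + d + ν)}

/-- `κ(x, y) = 2 sup {‖l + ∇ₓ f(x, y)‖ : l ∈ ∂r₁(x)}`. -/
def kappa (f : E → F → ℝ) (r₁ : E → ℝ) (x : E) (y : F) : ℝ :=
  2 * sSup ((fun l => ‖l + gradX f x y‖) '' clarkeSubdiff r₁ x)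

/-- The set-valued map `H` for which the differential inclusion of the subgradient descent-ascent
method reads `d(x, y)/dt ∈ -H(x, y)`. -/
def sgdaField (X : Set E) (Y : Set F) (f : E → F → ℝ) (r₁ : E → ℝ) (r₂ : F → ℝ) (η θ : ℝ)
    (z : E × F) : Set (E × F) :=
  {w : E × F |
    (∃ l ∈ clarkeSubdiff r₁ z.1, ∃ ν ∈ normalCone X z.1,
      ‖ν‖ ≤ kappa f r₁ z.1 z.2 ∧ w.1 = l + gradX f z.1 z.2 + ν) ∧
    (∃ R ∈ proxResidual Y f r₂ η z.1 z.2, w.2 = -(θ • R))}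

end Minimax

end

end MinimaxFlow

namespace MinimaxFlow

/-! ### Absolutely continuous curves -/

section AbsolutelyContinuous

variable {U V : Type*} [NormedAddCommGroup U] [NormedAddCommGroup V]

/-! Along a solution `γ = (x, y)`, write `a = ‖x'‖` and `b = ‖R‖`, where `R = (T - y)/η` and `T` is
the proximal maximizer, so that `y' = θ R`. Everything rests on the dissipation inequality `(Γ ∘ γ)'
≤ -a²/4 - (αημθ/6) b²`, valid almost everywhere (`IsProxMap.ae_dissipation`).

The terms of `Γ` contribute as follows. The Clarke subgradients of `r₁` obey a chain rule because
they lie in the convex hull of any conservative field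
(`IsConservativeFieldFor.chainRule_clarkeSubdiff`). The normal vector `ν` is orthogonal to `x'`
because `x` stays in `X`. Hence `∇ₓf` and `r₁` together give `-a²`. An envelope argument
(`IsProxMap.deriv_envelope_eq`) differentiates `Ψ` with `T` frozen. This gives `⟨∇ₓf, x'⟩ + η⟨g', R⟩
+ θb²`, where `g'` is the time derivative of `∇_y f` along `γ`. Strong concavity and the Lipschitz
bound yield `⟨g', R⟩ ≤ L a b - μθ b²` (`inner_deriv_gradY_le`), from first-order increments alone.
Finally, `(α - 1)(r₂ - f)` contributes at most `-(α - 1)θ b²` in the `y` direction, by the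
variational inequality of the proximal map. The sum is a quadratic form in `(a, b)`, and the lower
bounds on `α` and `θ` make it nonpositive (`dissipation_bound`).

If `Γ` fails to decrease strictly up to time `t`, its derivative vanishes almost everywhere on `[0,
t]`. Then `γ' = 0` almost everywhere, so `γ` is constant and `0 ∈ H (γ 0)`. A vanishing residual
makes `y` a fixed point of the proximal step, which a minimax argument turns into the stationarity
inclusion in `y`. Admissibility of `H` follows from the compactness of Clarke subdifferentials and
the continuity of the proximal map. -/

theorem _root_.LipschitzOnWith.comp_absolutelyContinuousOnInterval {K : NNReal} {g : U → V}
    {s : Set U} (hg : LipschitzOnWith K g s) {γ : ℝ → U} {a b : ℝ}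
    (hγ : AbsolutelyContinuousOnInterval γ a b) (hs : MapsTo γ (uIcc a b) s) :
    AbsolutelyContinuousOnInterval (fun t => g (γ t)) a b := by
  rw [absolutelyContinuousOnInterval_iff] at hγ ⊢
  intro ε hε
  have hK : (0 : ℝ) < K + 1 := by positivity
  obtain ⟨δ, hδ, h⟩ := hγ (ε / (K + 1)) (by positivity)
  refine ⟨δ, hδ, fun I hI hlen => ?_⟩
  have h1 := h I hI hlen
  calc _ ≤ ∑ i ∈ Finset.range I.1, (K + 1 : ℝ) * dist (γ (I.2 i).1) (γ (I.2 i).2) := by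
        refine Finset.sum_le_sum fun i hi => ?_
        have hm := hI.1 i hi
        refine (hg.dist_le_mul _ (hs hm.1) _ (hs hm.2)).trans ?_
        gcongr
        linarith
    _ < ε := by
        rw [← Finset.mul_sum]
        rw [lt_div_iff₀ hK] at h1
        linarith

theorem _root_.LocallyLipschitz.comp_absolutelyContinuousOnInterval {g : U → V}
    (hg : LocallyLipschitz g) {γ : ℝ → U} {a b : ℝ}
    (hγ : AbsolutelyContinuousOnInterval γ a b) :
    AbsolutelyContinuousOnInterval (fun t => g (γ t)) a b := by
  obtain ⟨K, hK⟩ := LocallyLipschitzOn.exists_lipschitzOnWith_of_compact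
    (isCompact_uIcc.image_of_continuousOn hγ.continuousOn) hg.locallyLipschitzOn
  exact hK.comp_absolutelyContinuousOnInterval hγ (mapsTo_image _ _)

theorem sub_le_of_ae_hasDerivAt_le {φ : ℝ → ℝ} {a b c : ℝ} (hab : a ≤ b)
    (hφ : AbsolutelyContinuousOnInterval φ a b)
    (h : ∀ᵐ t ∂(volume.restrict (Icc a b)), ∃ d, HasDerivAt φ d t ∧ d ≤ c) :
    φ b - φ a ≤ c * (b - a) := by
  rw [← hφ.integral_deriv_eq_sub]
  have : ∫ t in a..b, deriv φ t ≤ ∫ _ in a..b, c := by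
    refine intervalIntegral.integral_mono_ae_restrict hab hφ.intervalIntegrable_deriv
      intervalIntegrable_const ?_
    filter_upwards [h] with t ht
    obtain ⟨d, hd, hdc⟩ := ht
    rw [hd.deriv]
    exact hdc
  refine this.trans (le_of_eq ?_)
  simp [mul_comm]

/-- The integral of the derivative is `φ b - φ a ≥ 0`, so a nonpositive integrand must vanish almost
everywhere. This is the equality case behind the strict decrease. -/
theorem ae_deriv_eq_zero_of_nonpos {φ : ℝ → ℝ} {a b : ℝ} (hab : a ≤ b)
    (hφ : AbsolutelyContinuousOnInterval φ a b)
    (h : ∀ᵐ t ∂(volume.restrict (Icc a b)), deriv φ t ≤ 0) (hle : φ a ≤ φ b) :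
    ∀ᵐ t ∂(volume.restrict (Icc a b)), deriv φ t = 0 := by
  have h0 : ∫ t in a..b, -deriv φ t = 0 := by
    have h1 : ∫ t in a..b, deriv φ t ≤ 0 := by
      rw [intervalIntegral.integral_of_le hab, ← integral_Icc_eq_integral_Ioc]
      exact integral_nonpos_of_ae h
    have := hφ.integral_deriv_eq_sub
    rw [intervalIntegral.integral_neg]
    linarith
  have hi := hφ.intervalIntegrable_deriv.neg
  rw [intervalIntegral.integral_of_le hab, ← integral_Icc_eq_integral_Ioc,
    integral_eq_zero_iff_of_nonneg_ae] at h0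
  · filter_upwards [h0] with t ht
    simpa using ht
  · filter_upwards [h] with t ht
    simpa using ht
  · rw [intervalIntegrable_iff_integrableOn_Icc_of_le hab] at hi
    exact hi

theorem ae_restrict_Icc_iff_Ioo {P : ℝ → Prop} {a b : ℝ} :
    (∀ᵐ t ∂(volume.restrict (Icc a b)), P t) ↔ ∀ᵐ t ∂(volume.restrict (Ioo a b)), P t := by
  rw [restrict_Ioo_eq_restrict_Icc]

theorem ae_exists_hasDerivAt [NormedSpace ℝ V] [FiniteDimensional ℝ V] {φ : ℝ → V} {a b : ℝ}
    (hab : a ≤ b) (hφ : AbsolutelyContinuousOnInterval φ a b) :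
    ∀ᵐ t ∂(volume.restrict (Icc a b)), ∃ v, HasDerivAt φ v t := by
  rw [ae_restrict_iff' measurableSet_Icc]
  filter_upwards [hφ.boundedVariationOn.ae_differentiableAt_of_mem_uIcc] with t ht htt
  rw [uIcc_of_le hab] at ht
  exact ⟨_, (ht htt).hasDerivAt⟩

/-- A set of full measure is dense, since nonempty open sets have positive measure; continuity and
closedness do the rest. -/
theorem mem_of_ae_mem {S : Set V} (hS : IsClosed S) {γ : ℝ → V} {a b : ℝ} (hab : a < b)
    (hγ : ContinuousOn γ (Icc a b)) (h : ∀ᵐ t ∂(volume.restrict (Icc a b)), γ t ∈ S) :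
    ∀ t ∈ Icc a b, γ t ∈ S := by
  have hd : Icc a b ⊆ closure {t | t ∈ Ioo a b ∧ γ t ∈ S} := by
    intro t ht
    rw [← closure_Ioo hab.ne] at ht
    rw [mem_closure_iff] at ht ⊢
    intro o ho hto
    have hne := ht o ho hto
    by_contra hcon
    have hpos : 0 < volume (o ∩ Ioo a b) := (ho.inter isOpen_Ioo).measure_pos _ hne
    rw [ae_restrict_iff' measurableSet_Icc, ae_iff] at h
    refine hpos.ne' (measure_mono_null ?_ h)
    intro s hs hmem
    exact hcon ⟨s, hs.1, hs.2, hmem (Ioo_subset_Icc_self hs.2)⟩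
  intro t ht
  have h1 : ContinuousWithinAt γ {t | t ∈ Ioo a b ∧ γ t ∈ S} t :=
    (hγ t ht).mono fun s hs => Ioo_subset_Icc_self hs.1
  have := h1.mem_closure_image (hd ht)
  refine hS.closure_subset_iff.2 ?_ this
  rintro _ ⟨s, hs, rfl⟩
  exact hs.2

end AbsolutelyContinuous

/-! ### Compactness of convex hulls and closed relations -/

section Hull

/-- By Carathéodory, at most `finrank + 1` points suffice. The hull is thus a finite union of
continuous images of a simplex times a power of `s`. -/
theorem _root_.IsCompact.convexHull_of_finiteDimensional {E : Type*} [NormedAddCommGroup E]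
    [NormedSpace ℝ E] [FiniteDimensional ℝ E] {s : Set E} (hs : IsCompact s) :
    IsCompact (convexHull ℝ s) := by
  let Φ : (m : ℕ) → (Fin m → ℝ) × (Fin m → E) → E := fun m q => ∑ i, q.1 i • q.2 i
  have key : convexHull ℝ s = ⋃ m ∈ Finset.range (Module.finrank ℝ E + 2),
      Φ m '' (stdSimplex ℝ (Fin m) ×ˢ (univ.pi fun _ => s)) := by
    apply Subset.antisymm
    · intro x hx
      obtain ⟨ι, _, z, w, hz, hind, hw, hw1, rfl⟩ := eq_pos_convex_span_of_mem_convexHull hx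
      have hcard := hind.card_le_finrank_succ
      let e := Fintype.equivFin ι
      refine mem_biUnion (x := Fintype.card ι) ?_ ⟨(w ∘ e.symm, z ∘ e.symm), ⟨⟨?_, ?_⟩, ?_⟩, ?_⟩
      · have := Submodule.finrank_le (vectorSpan ℝ (range z))
        simp only [Finset.coe_range, mem_Iio]
        omega
      · exact fun i => (hw _).le
      · rw [← hw1]
        exact e.symm.sum_comp w
      · exact fun i _ => hz (mem_range_self _)
      · exact e.symm.sum_comp fun i => w i • z i
    · refine iUnion₂_subset fun m _ => ?_
      rintro _ ⟨q, ⟨⟨h0, h1⟩, h2⟩, rfl⟩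
      exact (convex_convexHull ℝ s).sum_mem (fun i _ => h0 i) h1
        fun i _ => subset_convexHull ℝ s (h2 i (mem_univ i))
  rw [key]
  refine Finset.isCompact_biUnion _ fun m _ => ?_
  refine ((isCompact_stdSimplex ℝ (Fin m)).prod (isCompact_univ_pi fun _ => hs)).image ?_
  fun_prop

/-- Projecting out `l` preserves closedness because local boundedness lets a subsequence of the
witnesses converge. All later closed-graph proofs go through this. -/
theorem isClosed_setOf_exists_mem {Z W V : Type*} [PseudoMetricSpace Z] [NormedAddCommGroup W]
    [NormedAddCommGroup V] [ProperSpace V] {D : W → Set V}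
    (hD : IsClosed {q : W × V | q.2 ∈ D q.1}) (hb : LocallyBoundedOn univ D)
    {a : Z → W} (ha : Continuous a) {P : Set (Z × V)} (hP : IsClosed P) :
    IsClosed {z : Z | ∃ l ∈ D (a z), (z, l) ∈ P} := by
  refine IsSeqClosed.isClosed fun z x hz hx => ?_
  choose l hl hlP using hz
  obtain ⟨B, hB, hbd⟩ := hb (a x) (mem_univ _)
  rw [nhdsWithin_univ] at hB
  have hax : Tendsto (fun k => a (z k)) atTop (𝓝 (a x)) := (ha.tendsto x).comp hx
  have hev : ∀ᶠ k in atTop, l k ∈ ⋃ u ∈ B, D u := by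
    filter_upwards [hax hB] with k hk
    exact mem_biUnion hk (hl k)
  obtain ⟨l', -, φ, hφ, hlim⟩ := tendsto_subseq_of_frequently_bounded hbd hev.frequently
  refine ⟨l', ?_, ?_⟩
  · exact hD.mem_of_tendsto ((hax.comp hφ.tendsto_atTop).prodMk_nhds hlim)
      (Eventually.of_forall fun k => hl _)
  · exact hP.mem_of_tendsto ((hx.comp hφ.tendsto_atTop).prodMk_nhds hlim)
      (Eventually.of_forall fun k => hlP _)

end Hull

/-! ### Set-valued fields with closed graph, and the Clarke subdifferential -/

section Fields

variable {E : Type*} [NormedAddCommGroup E] [InnerProductSpace ℝ E]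

/-- A locally bounded set-valued map with closed graph and nonempty values. -/
structure IsClosedField (D : E → Set E) : Prop where
  nonempty : ∀ x, (D x).Nonempty
  closedGraph : IsClosed {q : E × E | q.2 ∈ D q.1}
  locallyBounded : LocallyBoundedOn univ D

theorem IsConservativeFieldFor.isClosedField {D : E → Set E} {r : E → ℝ}
    (h : IsConservativeFieldFor D r) : IsClosedField D :=
  ⟨h.nonempty, h.closedGraph, h.locallyBounded⟩

variable [FiniteDimensional ℝ E]

theorem IsClosedField.isCompact {D : E → Set E} (hD : IsClosedField D) (x : E) :
    IsCompact (D x) := by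
  obtain ⟨B, hB, hbd⟩ := hD.locallyBounded x (mem_univ _)
  rw [nhdsWithin_univ] at hB
  refine Metric.isCompact_of_isClosed_isBounded ?_
    (hbd.subset (subset_biUnion_of_mem (u := D) (mem_of_mem_nhds hB)))
  exact hD.closedGraph.preimage (Continuous.prodMk_right x)

/-- Upper semicontinuity of the support function: a strict bound `⟨d, u⟩ < c` on `D x` persists on
`D y` for `y` near `x`. -/
theorem IsClosedField.isClosed_setOf_le_inner {D : E → Set E} (hD : IsClosedField D)
    (u : E) (c : ℝ) : IsClosed {x : E | ∃ d ∈ D x, c ≤ inner ℝ d u} := by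
  refine isClosed_setOf_exists_mem hD.closedGraph hD.locallyBounded continuous_id
    (P := {q : E × E | c ≤ inner ℝ q.2 u}) ?_
  exact isClosed_le continuous_const (by fun_prop)

theorem IsClosedField.exists_separation {D : E → Set E} (hD : IsClosedField D) {x g : E}
    (hg : g ∉ convexHull ℝ (D x)) :
    ∃ (u : E) (c : ℝ), (∀ d ∈ D x, inner ℝ d u < c) ∧ c < inner ℝ g u := by
  have : CompleteSpace E := FiniteDimensional.complete ℝ E
  obtain ⟨φ, c, h1, h2⟩ := geometric_hahn_banach_closed_point (convex_convexHull ℝ (D x))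
    (hD.isCompact x).convexHull_of_finiteDimensional.isClosed hg
  have hφ : ∀ v, inner ℝ v ((InnerProductSpace.toDual ℝ E).symm φ) = φ v := fun v => by
    rw [real_inner_comm, InnerProductSpace.toDual_symm_apply]
  refine ⟨(InnerProductSpace.toDual ℝ E).symm φ, c, fun d hd => ?_, ?_⟩
  · rw [hφ]
    exact h1 d (subset_convexHull ℝ _ hd)
  · rwa [hφ]

theorem IsClosedField.hull {D : E → Set E} (hD : IsClosedField D) :
    IsClosedField fun x => convexHull ℝ (D x) := by
  refine ⟨fun x => (hD.nonempty x).mono (subset_convexHull ℝ _), ?_, ?_⟩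
  -- A hyperplane separating `g` from the hull at `x` still separates nearby vectors from the hulls
  -- at nearby points.
  · rw [← isOpen_compl_iff, isOpen_iff_mem_nhds]
    rintro ⟨x, g⟩ hg
    obtain ⟨u, c, h1, h2⟩ := hD.exists_separation hg
    have hu : IsOpen {q : E × E | c < inner ℝ q.2 u} :=
      isOpen_lt continuous_const (continuous_snd.inner continuous_const)
    have ho : IsOpen {q : E × E | q.1 ∉ {x : E | ∃ d ∈ D x, c ≤ inner ℝ d u} ∧
        c < inner ℝ q.2 u} :=
      ((hD.isClosed_setOf_le_inner u c).isOpen_compl.preimage continuous_fst).inter hu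
    refine mem_of_superset (ho.mem_nhds ⟨?_, h2⟩) ?_
    · rintro ⟨d, hd, hc⟩
      exact absurd (h1 d hd) (not_lt.2 hc)
    · rintro ⟨y, v⟩ ⟨hy, hv⟩ hmem
      have hsub : convexHull ℝ (D y) ⊆ {d | inner ℝ d u ≤ c} := by
        refine convexHull_min (fun d hd => ?_) ?_
        · by_contra hcon
          exact hy ⟨d, hd, (not_le.1 hcon).le⟩
        · have : {d : E | inner ℝ d u ≤ c} = {d : E | innerₛₗ ℝ u d ≤ c} := by
            ext d
            simp [real_inner_comm]
          rw [this]
          exact convex_halfSpace_le (LinearMap.isLinear _) c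
      exact absurd (hsub hmem) (not_le.2 hv)
  · intro x hx
    obtain ⟨B, hB, hbd⟩ := hD.locallyBounded x hx
    refine ⟨B, hB, ?_⟩
    refine (isBounded_convexHull.2 hbd).subset (iUnion₂_subset fun z hz => ?_)
    exact convexHull_mono (subset_biUnion_of_mem (u := D) hz)

end Fields

section Density

variable {E : Type*} [NormedAddCommGroup E] [InnerProductSpace ℝ E] [FiniteDimensional ℝ E]

/-- Rademacher's theorem on a small open set, where null sets have nonempty complement. -/
theorem dense_differentiableAt {r : E → ℝ} (hr : LocallyLipschitz r) :
    Dense {x | DifferentiableAt ℝ r x} := by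
  intro x
  rw [mem_closure_iff]
  intro o ho hxo
  obtain ⟨K, t, ht, hK⟩ := hr x
  let _ : MeasurableSpace E := borel E
  have : BorelSpace E := ⟨rfl⟩
  let μ : Measure E := Measure.addHaar
  have hopen : IsOpen (interior t ∩ o) := isOpen_interior.inter ho
  have h := (hK.mono (inter_subset_left.trans interior_subset :
    interior t ∩ o ⊆ t)).ae_differentiableWithinAt_of_mem (μ := μ)
  have hpos : 0 < μ (interior t ∩ o) :=
    hopen.measure_pos μ ⟨x, mem_interior_iff_mem_nhds.2 ht, hxo⟩
  by_contra hcon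
  rw [ae_iff] at h
  refine hpos.ne' (measure_mono_null ?_ h)
  intro z hz hmem
  exact hcon ⟨z, hz.2, (hmem hz).differentiableAt (hopen.mem_nhds hz)⟩

theorem exists_seq_differentiableAt {r : E → ℝ} (hr : LocallyLipschitz r) (x : E) :
    ∃ z : ℕ → E, (∀ k, DifferentiableAt ℝ r (z k)) ∧ Tendsto z atTop (𝓝 x) := by
  obtain ⟨z, h1, h2⟩ := mem_closure_iff_seq_limit.1 (dense_differentiableAt hr x)
  exact ⟨z, h1, h2⟩

end Density

/-! ### Clarke subgradients as limits of gradients, and their link with conservative fields. -/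

section Clarke

variable {E : Type*} [NormedAddCommGroup E] [InnerProductSpace ℝ E] [CompleteSpace E]

/-- The limits of gradients along sequences of points of differentiability converging to `x`. -/
def limitingGradients (r : E → ℝ) (x : E) : Set E :=
  {g : E | ∃ z : ℕ → E, (∀ k, DifferentiableAt ℝ r (z k)) ∧
    Tendsto z atTop (𝓝 x) ∧ Tendsto (fun k => gradient r (z k)) atTop (𝓝 g)}

theorem graph_limitingGradients (r : E → ℝ) :
    {q : E × E | q.2 ∈ limitingGradients r q.1} =
      closure {q : E × E | DifferentiableAt ℝ r q.1 ∧ q.2 = gradient r q.1} := by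
  ext ⟨x, g⟩
  rw [mem_closure_iff_seq_limit]
  constructor
  · rintro ⟨z, hz, hx, hg⟩
    exact ⟨fun k => (z k, gradient r (z k)), fun k => ⟨hz k, rfl⟩, hx.prodMk_nhds hg⟩
  · rintro ⟨q, hq, hlim⟩
    refine ⟨fun k => (q k).1, fun k => (hq k).1, (continuous_fst.tendsto _).comp hlim, ?_⟩
    have := (continuous_snd.tendsto _).comp hlim
    exact this.congr fun k => (hq k).2

theorem norm_gradient_le_of_lipschitzOnWith {r : E → ℝ} {K : NNReal} {s : Set E} {x : E}
    (hr : LipschitzOnWith K r s) (hs : s ∈ 𝓝 x) : ‖gradient r x‖ ≤ K := by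
  rw [gradient, LinearIsometryEquiv.norm_map]
  exact norm_fderiv_le_of_lipschitzOn ℝ hs hr

theorem locallyBoundedOn_limitingGradients {r : E → ℝ} (hr : LocallyLipschitz r) :
    LocallyBoundedOn univ (limitingGradients r) := by
  intro x _
  obtain ⟨K, t, ht, hK⟩ := hr x
  rw [nhdsWithin_univ]
  refine ⟨interior t, interior_mem_nhds.2 ht, Metric.isBounded_closedBall.subset
    (iUnion₂_subset fun u hu => ?_) (t := Metric.closedBall 0 K)⟩
  rintro g ⟨z, -, hz, hg⟩
  refine mem_closedBall_zero_iff.2 (le_of_tendsto hg.norm ?_)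
  filter_upwards [hz (isOpen_interior.mem_nhds hu)] with k hk
  exact norm_gradient_le_of_lipschitzOnWith hK (mem_interior_iff_mem_nhds.1 hk)

theorem gradient_mem_limitingGradients {r : E → ℝ} {x : E} (hx : DifferentiableAt ℝ r x) :
    gradient r x ∈ limitingGradients r x :=
  ⟨fun _ => x, fun _ => hx, tendsto_const_nhds, tendsto_const_nhds⟩

theorem HasGradientAt.inner_le_of_eventually_le {r : E → ℝ} {x u g : E} {c : ℝ}
    (hr : HasGradientAt r g x) (h : ∀ᶠ s in 𝓝[>] (0 : ℝ), r (x + s • u) - r x ≤ c * s) :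
    inner ℝ g u ≤ c := by
  have hline : HasDerivAt (fun s : ℝ => x + s • u) u 0 := by
    simpa using ((hasDerivAt_id (0 : ℝ)).smul_const u).const_add x
  have hd : HasDerivAt (fun s : ℝ => r (x + s • u)) (inner ℝ g u) 0 := by
    have h0 : HasFDerivAt r (InnerProductSpace.toDual ℝ E g) (x + (0 : ℝ) • u) := by
      simpa using hr.hasFDerivAt
    simpa [Function.comp_def] using h0.comp_hasDerivAt (0 : ℝ) hline
  have hs := hd.tendsto_slope_zero_right
  refine le_of_tendsto hs ?_
  filter_upwards [h, self_mem_nhdsWithin] with s hs hs0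
  have hs0 : 0 < s := hs0
  simp only [zero_add, zero_smul, add_zero, smul_eq_mul]
  rw [inv_mul_le_iff₀ hs0]
  linarith

variable [FiniteDimensional ℝ E]

theorem isClosedField_limitingGradients {r : E → ℝ} (hr : LocallyLipschitz r) :
    IsClosedField (limitingGradients r) := by
  refine ⟨fun x => ?_, ?_, locallyBoundedOn_limitingGradients hr⟩
  · obtain ⟨z, hz, hlim⟩ := exists_seq_differentiableAt hr x
    obtain ⟨K, t, ht, hK⟩ := hr x
    have hev : ∀ᶠ k in atTop, gradient r (z k) ∈ Metric.closedBall (0 : E) K := by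
      filter_upwards [hlim (interior_mem_nhds.2 ht)] with k hk
      exact mem_closedBall_zero_iff.2
        (norm_gradient_le_of_lipschitzOnWith hK (mem_interior_iff_mem_nhds.1 hk))
    obtain ⟨g, -, φ, hφ, hg⟩ :=
      tendsto_subseq_of_frequently_bounded Metric.isBounded_closedBall hev.frequently
    exact ⟨g, z ∘ φ, fun k => hz _, hlim.comp hφ.tendsto_atTop, hg⟩
  · rw [graph_limitingGradients]
    exact isClosed_closure

theorem isClosedField_clarkeSubdiff {r : E → ℝ} (hr : LocallyLipschitz r) :
    IsClosedField (clarkeSubdiff r) :=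
  (isClosedField_limitingGradients hr).hull

theorem limitingGradients_subset_convexHull {D : E → Set E} (hD : IsClosedField D) {r : E → ℝ}
    (h : ∀ x, DifferentiableAt ℝ r x → gradient r x ∈ convexHull ℝ (D x)) (x : E) :
    limitingGradients r x ⊆ convexHull ℝ (D x) := by
  rintro g ⟨z, hz, hx, hg⟩
  exact hD.hull.closedGraph.mem_of_tendsto (hx.prodMk_nhds hg)
    (Eventually.of_forall fun k => h _ (hz k))

/-- If a direction `u` separated the gradient from `D x`, then `⟨d, u⟩ < c` would hold on `D` near
`x`. Integrating the chain rule along the segment `x + s u` would bound the directional derivative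
by `c`, against the separation. -/
theorem IsConservativeFieldFor.gradient_mem_convexHull {D : E → Set E} {r : E → ℝ}
    (hD : IsConservativeFieldFor D r) (hr : LocallyLipschitz r) {x : E}
    (hx : DifferentiableAt ℝ r x) : gradient r x ∈ convexHull ℝ (D x) := by
  by_contra hcon
  obtain ⟨u, c, h1, h2⟩ := hD.isClosedField.exists_separation hcon
  refine absurd (HasGradientAt.inner_le_of_eventually_le hx.hasGradientAt (c := c) (u := u) ?_)
    (not_le.2 h2)
  have hopen := (hD.isClosedField.isClosed_setOf_le_inner u c).isOpen_compl
  have hxm : x ∈ {x : E | ∃ d ∈ D x, c ≤ inner ℝ d u}ᶜ := by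
    rintro ⟨d, hd, hc⟩
    exact absurd (h1 d hd) (not_lt.2 hc)
  have hcont : Continuous fun s : ℝ => x + s • u := by fun_prop
  have hmem : (fun s : ℝ => x + s • u) ⁻¹' {x : E | ∃ d ∈ D x, c ≤ inner ℝ d u}ᶜ ∈ 𝓝 (0 : ℝ) :=
    hcont.continuousAt.preimage_mem_nhds (hopen.mem_nhds (by simpa using hxm))
  obtain ⟨ε, hε, hball⟩ := Metric.mem_nhds_iff.1 hmem
  filter_upwards [Ioo_mem_nhdsGT hε] with h hh
  have hline : LocallyLipschitz fun s : ℝ => x + s • u :=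
    ContDiff.locallyLipschitz (𝕂 := ℝ) (by fun_prop)
  have hac0 : AbsolutelyContinuousOnInterval (fun s : ℝ => s) 0 h :=
    (LipschitzWith.id.lipschitzOnWith (s := uIcc 0 h)).absolutelyContinuousOnInterval
  have hac := hline.comp_absolutelyContinuousOnInterval hac0
  have hrac := hr.comp_absolutelyContinuousOnInterval hac
  have := sub_le_of_ae_hasDerivAt_le hh.1.le hrac (c := c) ?_
  · simpa using this
  · filter_upwards [hD.chainRule 0 h _ hh.1 hac, ae_restrict_mem measurableSet_Icc] with s hs hsI
    obtain ⟨v, hv, hd⟩ := hs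
    obtain ⟨d, hdm⟩ := hD.nonempty (x + s • u)
    refine ⟨_, hd d hdm, ?_⟩
    have hvu : v = u := hv.unique
      (by simpa using ((hasDerivAt_id (s : ℝ)).smul_const u).const_add x)
    rw [hvu]
    have hmem : s ∈ Metric.ball (0 : ℝ) ε := by
      rw [Metric.mem_ball, dist_zero_right, Real.norm_eq_abs, abs_of_nonneg hsI.1]
      exact hsI.2.trans_lt hh.2
    by_contra hc
    exact hball hmem ⟨d, hdm, (not_le.1 hc).le⟩

/-- Clarke subgradients obey the chain rule of every conservative field of the same potential. -/
theorem IsConservativeFieldFor.chainRule_clarkeSubdiff {D : E → Set E} {r : E → ℝ}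
    (hD : IsConservativeFieldFor D r) (hr : LocallyLipschitz r) {a b : ℝ} {γ : ℝ → E}
    (hab : a < b) (hγ : AbsolutelyContinuousOnInterval γ a b) :
    ∀ᵐ t ∂(volume.restrict (Icc a b)), ∃ v : E, HasDerivAt γ v t ∧
      ∀ d ∈ clarkeSubdiff r (γ t), HasDerivAt (fun s => r (γ s)) (inner ℝ d v) t := by
  filter_upwards [hD.chainRule a b γ hab hγ] with t ht
  obtain ⟨v, hv, hd⟩ := ht
  refine ⟨v, hv, fun d hdm => ?_⟩
  have hsub : clarkeSubdiff r (γ t) ⊆ convexHull ℝ (D (γ t)) :=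
    convexHull_min (limitingGradients_subset_convexHull hD.isClosedField
      (fun x hx => hD.gradient_mem_convexHull hr hx) (γ t)) (convex_convexHull ℝ _)
  obtain ⟨d₀, hd₀⟩ := hD.nonempty (γ t)
  -- All elements of `D (γ t)` compute the same derivative, so `⟨·, v⟩` is constant on `D (γ t)`,
  -- hence on its hull.
  have heq : convexHull ℝ (D (γ t)) ⊆ {d | inner ℝ d v = inner ℝ d₀ v} := by
    refine convexHull_min (fun d hd' => (hd d hd').unique (hd d₀ hd₀)) ?_
    have : {d : E | inner ℝ d v = inner ℝ d₀ v} = {d : E | innerₛₗ ℝ v d = inner ℝ d₀ v} := by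
      ext d
      simp [real_inner_comm]
    rw [this]
    exact convex_hyperplane (LinearMap.isLinear _) _
  have h1 : inner ℝ d v = inner ℝ d₀ v := heq (hsub hdm)
  rw [h1]
  exact hd d₀ hd₀

end Clarke

/-! ### Gradient inequalities for convex and strongly concave functions -/

section Gradient

variable {F : Type*} [NormedAddCommGroup F] [InnerProductSpace ℝ F] [CompleteSpace F]

theorem HasGradientAt.inner_sub_le_of_convexOn {r : F → ℝ} {x g : F} (hr : HasGradientAt r g x)
    (hc : ConvexOn ℝ univ r) (v : F) : inner ℝ g (v - x) ≤ r v - r x := by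
  refine HasGradientAt.inner_le_of_eventually_le hr ?_
  filter_upwards [Ioo_mem_nhdsGT (zero_lt_one' ℝ)] with s hs
  have h := hc.2 (mem_univ x) (mem_univ v) (sub_nonneg.2 hs.2.le) hs.1.le (by ring)
  have e : (1 - s) • x + s • v = x + s • (v - x) := by module
  rw [e] at h
  simp only [smul_eq_mul] at h
  linarith

theorem HasGradientAt.le_of_strongConcaveOn {φ : F → ℝ} {Y : Set F} {m : ℝ} {y g : F}
    (hg : HasGradientAt φ g y) (hc : StrongConcaveOn Y m φ) (hm : 0 ≤ m) (hy : y ∈ Y) {v : F}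
    (hv : v ∈ Y) : φ v ≤ φ y + inner ℝ g (v - y) - m / 2 * ‖v - y‖ ^ 2 := by
  -- Strong concavity at `y + s (v - y)` carries a factor `1 - s`. It is bounded below by `1 - ε`
  -- for `s < ε`, and then `ε` tends to `0`.
  have key : ∀ ε ∈ Ioo (0 : ℝ) 1,
      φ v - φ y + (1 - ε) * (m / 2 * ‖v - y‖ ^ 2) ≤ inner ℝ g (v - y) := by
    intro ε hε
    have hneg : HasGradientAt (fun y => -φ y) (-g) y := by
      rw [hasGradientAt_iff_hasFDerivAt, map_neg]
      exact hg.hasFDerivAt.neg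
    have h := HasGradientAt.inner_le_of_eventually_le hneg (u := v - y)
      (c := -(φ v - φ y + (1 - ε) * (m / 2 * ‖v - y‖ ^ 2))) ?_
    · rw [inner_neg_left] at h
      linarith
    filter_upwards [Ioo_mem_nhdsGT hε.1] with s hs
    have h := hc.2 hy hv (sub_nonneg.2 (hs.2.trans hε.2).le) hs.1.le (by ring)
    have e : (1 - s) • y + s • v = y + s • (v - y) := by module
    rw [e, norm_sub_rev] at h
    simp only [smul_eq_mul] at h
    have h2 : 0 ≤ s * (ε - s) * (m / 2 * ‖v - y‖ ^ 2) :=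
      mul_nonneg (mul_nonneg hs.1.le (by linarith [hs.2])) (by positivity)
    nlinarith [h, h2]
  have hlim : Tendsto (fun ε : ℝ => φ v - φ y + (1 - ε) * (m / 2 * ‖v - y‖ ^ 2)) (𝓝[>] 0)
      (𝓝 (φ v - φ y + (1 - 0) * (m / 2 * ‖v - y‖ ^ 2))) := by
    refine Tendsto.mono_left (Continuous.tendsto ?_ _) nhdsWithin_le_nhds
    fun_prop
  have := le_of_tendsto hlim (by
    filter_upwards [Ioo_mem_nhdsGT (zero_lt_one' ℝ)] with ε hε using key ε hε)
  linarith

theorem inner_gradient_sub_le_of_strongConcaveOn {φ : F → ℝ} {Y : Set F} {m : ℝ}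
    (hd : Differentiable ℝ φ) (hc : StrongConcaveOn Y m φ) (hm : 0 ≤ m) {y v : F} (hy : y ∈ Y)
    (hv : v ∈ Y) : inner ℝ (gradient φ v - gradient φ y) (v - y) ≤ -m * ‖v - y‖ ^ 2 := by
  have h1 := HasGradientAt.le_of_strongConcaveOn (hd y).hasGradientAt hc hm hy hv
  have h2 := HasGradientAt.le_of_strongConcaveOn (hd v).hasGradientAt hc hm hv hy
  have e : inner ℝ (gradient φ v) (y - v) = -inner ℝ (gradient φ v) (v - y) := by
    rw [← inner_neg_right, neg_sub]
  rw [e, norm_sub_rev] at h2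
  rw [inner_sub_left]
  linarith

theorem nonneg_of_forall_add_sq_nonneg {A B : ℝ}
    (h : ∀ s ∈ Ioo (0 : ℝ) 1, 0 ≤ s * A + s ^ 2 * B) : 0 ≤ A := by
  have hlim : Tendsto (fun s : ℝ => A + s * B) (𝓝[>] 0) (𝓝 (A + 0 * B)) := by
    refine Tendsto.mono_left (Continuous.tendsto ?_ _) nhdsWithin_le_nhds
    fun_prop
  have := ge_of_tendsto (b := 0) hlim (by
    filter_upwards [Ioo_mem_nhdsGT (zero_lt_one' ℝ)] with s hs
    have := h s hs
    have e : s * A + s ^ 2 * B = s * (A + s * B) := by ring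
    rw [e] at this
    exact nonneg_of_mul_nonneg_right this hs.1)
  linarith

end Gradient

/-! ### Clarke subgradients of convex functions and constrained optimality -/

section Convex

variable {F : Type*} [NormedAddCommGroup F] [InnerProductSpace ℝ F] [CompleteSpace F]

theorem inner_sub_le_of_mem_limitingGradients {r : F → ℝ} (hr : ConvexOn ℝ univ r)
    (hcont : Continuous r) {x g : F} (hg : g ∈ limitingGradients r x) (v : F) :
    inner ℝ g (v - x) ≤ r v - r x := by
  obtain ⟨z, hz, hx, hlim⟩ := hg
  refine le_of_tendsto_of_tendsto (hlim.inner (tendsto_const_nhds.sub hx))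
    (tendsto_const_nhds.sub ((hcont.tendsto x).comp hx)) (Eventually.of_forall fun k => ?_)
  exact HasGradientAt.inner_sub_le_of_convexOn (hz k).hasGradientAt hr v

variable [FiniteDimensional ℝ F]

/-- Otherwise all gradients near `y` satisfy `⟨∇r, u⟩ < c < ⟨g, u⟩`. Convexity at points of
differentiability tending to `y + s u` gives `r (y + s u) - r y ≤ s c`, which contradicts minimality
for small `s`. -/
theorem exists_le_inner_of_isConstrainedMin {r : F → ℝ} (hLip : LocallyLipschitz r)
    (hr : ConvexOn ℝ univ r) {y u g : F} {C : ℝ}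
    (hmin : ∀ s ∈ Ioo (0 : ℝ) 1, r y ≤ r (y + s • u) - s * inner ℝ g u + s ^ 2 * C) :
    ∃ d ∈ clarkeSubdiff r y, inner ℝ g u ≤ inner ℝ d u := by
  have hG := isClosedField_limitingGradients hLip
  obtain ⟨m, hm, hmax⟩ := (hG.isCompact y).exists_isMaxOn (hG.nonempty y)
    (f := fun d => inner ℝ d u) (by fun_prop)
  refine ⟨m, subset_convexHull ℝ _ hm, ?_⟩
  by_contra! hlt
  obtain ⟨c, hc1, hc2⟩ := exists_between hlt
  have hopen := (hG.isClosed_setOf_le_inner u c).isOpen_compl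
  have hy : y ∈ {x : F | ∃ d ∈ limitingGradients r x, c ≤ inner ℝ d u}ᶜ := by
    rintro ⟨d, hd, hcd⟩
    have := hmax hd
    simp only [mem_ofPred_eq] at this
    linarith
  have hcont : Continuous fun s : ℝ => y + s • u := by fun_prop
  have hmem : (fun s : ℝ => y + s • u) ⁻¹' _ ∈ 𝓝 (0 : ℝ) :=
    hcont.continuousAt.preimage_mem_nhds (hopen.mem_nhds (by simpa using hy))
  have hle : ∀ᶠ s in 𝓝[>] (0 : ℝ), s ∈ Ioo (0 : ℝ) 1 ∧ r (y + s • u) - r y ≤ s * c := by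
    filter_upwards [Ioo_mem_nhdsGT (zero_lt_one' ℝ), nhdsWithin_le_nhds hmem] with s hs hsm
    refine ⟨hs, ?_⟩
    obtain ⟨z, hz, hlim⟩ := exists_seq_differentiableAt hLip (y + s • u)
    have h1 : Tendsto (fun k => r (z k) - r (z k - s • u)) atTop
        (𝓝 (r (y + s • u) - r (y + s • u - s • u))) :=
      ((hLip.continuous.tendsto _).comp hlim).sub
        ((hLip.continuous.tendsto _).comp (hlim.sub_const _))
    rw [add_sub_cancel_right] at h1
    refine le_of_tendsto h1 ?_
    filter_upwards [hlim (hopen.mem_nhds hsm)] with k hk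
    have h2 := HasGradientAt.inner_sub_le_of_convexOn (hz k).hasGradientAt hr (z k - s • u)
    have e : z k - s • u - z k = -(s • u) := by abel
    rw [e, inner_neg_right, inner_smul_right] at h2
    have h3 : inner ℝ (gradient r (z k)) u < c := by
      by_contra! hcon
      exact hk ⟨_, gradient_mem_limitingGradients (hz k), hcon⟩
    have := mul_le_mul_of_nonneg_left h3.le hs.1.le
    linarith
  have hlim : Tendsto (fun s : ℝ => inner ℝ g u - s * C) (𝓝[>] 0)
      (𝓝 (inner ℝ g u - 0 * C)) := by
    refine Tendsto.mono_left (Continuous.tendsto ?_ _) nhdsWithin_le_nhds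
    fun_prop
  have := le_of_tendsto hlim (b := c) (by
    filter_upwards [hle] with s hs
    have h1 := hmin s hs.1
    have h2 : s * (inner ℝ g u - s * C) ≤ s * c := by nlinarith [hs.2]
    exact le_of_mul_le_mul_left h2 hs.1.1)
  linarith

/-- The preceding lemma supplies a subgradient depending on the direction; a minimax argument makes
one subgradient serve all directions. If none did, compactness and the finite form of Sion's theorem
would produce one `v ∈ Y` violating the inequality for every subgradient. -/
theorem exists_mem_clarkeSubdiff_add_normalCone {r : F → ℝ} (hLip : LocallyLipschitz r)
    (hr : ConvexOn ℝ univ r) {Y : Set F} (hY : Convex ℝ Y) {y g : F} (hy : y ∈ Y)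
    (hmin : ∀ v ∈ Y, inner ℝ g (v - y) ≤ r v - r y) :
    ∃ d ∈ clarkeSubdiff r y, ∃ ν ∈ normalCone Y y, 0 = -g + d + ν := by
  have hK := isClosedField_clarkeSubdiff hLip
  suffices h : ∃ d ∈ clarkeSubdiff r y, ∀ v ∈ Y, inner ℝ (g - d) (v - y) ≤ 0 by
    obtain ⟨d, hd, h⟩ := h
    exact ⟨d, hd, g - d, ⟨hy, h⟩, by abel⟩
  by_contra! hcon
  have hcov : clarkeSubdiff r y ⊆ ⋃ v ∈ Y, {d | 0 < inner ℝ (g - d) (v - y)} := by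
    intro d hd
    obtain ⟨v, hv, h⟩ := hcon d hd
    exact mem_biUnion hv h
  obtain ⟨s, hsY, hs, hcov⟩ := (hK.isCompact y).elim_finite_subcover_image
    (fun v _ => isOpen_lt continuous_const (by fun_prop)) hcov
  obtain ⟨v, hv, h⟩ := Sion.exists_lt_iInf_of_lt_iInf_of_finite (hK.nonempty y) (hK.isCompact y)
    (f := fun d v => inner ℝ (g - d) (v - y)) (Y := Y) (t := 0)
    (fun v _ => Continuous.lowerSemicontinuous (by fun_prop) |>.lowerSemicontinuousOn _)
    (fun v _ => ConvexOn.quasiconvexOn ⟨convex_convexHull ℝ _, fun a _ b _ p q _ _ hpq => by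
      have e : g - (p • a + q • b) = p • (g - a) + q • (g - b) := by
        have : g = (p + q) • g := by rw [hpq, one_smul]
        nth_rw 1 [this]
        module
      beta_reduce
      rw [e, inner_add_left, inner_smul_left, inner_smul_left]
      simp⟩) hY
    (fun d _ => Continuous.upperSemicontinuous (by fun_prop) |>.upperSemicontinuousOn _)
    (fun d _ => ConcaveOn.quasiconcaveOn ⟨hY, fun a _ b _ p q _ _ hpq => by
      have e : p • a + q • b - y = p • (a - y) + q • (b - y) := by
        have : y = (p + q) • y := by rw [hpq, one_smul]
        nth_rw 1 [this]
        module
      beta_reduce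
      rw [e, inner_add_right, inner_smul_right, inner_smul_right]
      simp⟩)
    (convex_convexHull ℝ _) hs hsY (fun d hd => by
      obtain ⟨v, hv, h⟩ := mem_iUnion₂.1 (hcov hd)
      exact ⟨v, hv, h⟩)
  obtain ⟨d, hd, hle⟩ := exists_le_inner_of_isConstrainedMin hLip hr (y := y) (u := v - y) (g := g)
    (C := 0) (fun s hs => by
      have hmem : y + s • (v - y) ∈ Y := hY.add_smul_sub_mem hy hv ⟨hs.1.le, hs.2.le⟩
      have := hmin _ hmem
      rw [add_sub_cancel_left, inner_smul_right] at this
      linarith)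
  have := h d hd
  rw [inner_sub_left] at this
  linarith

end Convex

/-! ### The proximal map -/

section Prox

variable {F : Type*} [NormedAddCommGroup F] [InnerProductSpace ℝ F]

/-- `P` is the proximal map of `r` restricted to `Y` with parameter `η`, described by its
variational inequality. -/
structure IsProxMap (Y : Set F) (r : F → ℝ) (η : ℝ) (P : F → F) : Prop where
  mem : ∀ u, P u ∈ Y
  le : ∀ u, ∀ v ∈ Y, inner ℝ (η⁻¹ • (u - P u)) (v - P u) ≤ r v - r (P u)

/-- Testing each variational inequality at the other point and adding cancels `r` and gives firm
nonexpansiveness. -/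
theorem IsProxMap.lipschitzWith {Y : Set F} {r : F → ℝ} {η : ℝ} {P : F → F} (hη : 0 < η)
    (hP : IsProxMap Y r η P) : LipschitzWith 1 P := by
  refine LipschitzWith.of_dist_le_mul fun u w => ?_
  rw [NNReal.coe_one, one_mul, dist_eq_norm, dist_eq_norm]
  have h1 := hP.le u _ (hP.mem w)
  have h2 := hP.le w _ (hP.mem u)
  rw [inner_smul_left] at h1 h2
  simp only [map_inv₀, conj_trivial] at h1 h2
  have h3 : η⁻¹ * (inner ℝ (u - P u) (P w - P u) + inner ℝ (w - P w) (P u - P w)) ≤ 0 := by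
    linarith
  have h4 : inner ℝ (u - P u) (P w - P u) + inner ℝ (w - P w) (P u - P w) ≤ 0 := by
    by_contra! hcon
    have := mul_pos (inv_pos.2 hη) hcon
    linarith
  have e : inner ℝ (u - P u) (P w - P u) + inner ℝ (w - P w) (P u - P w) =
      ‖P u - P w‖ ^ 2 - inner ℝ (u - w) (P u - P w) := by
    rw [← real_inner_self_eq_norm_sq]
    simp only [inner_sub_left, inner_sub_right]
    ring
  have h5 := real_inner_le_norm (u - w) (P u - P w)
  by_contra! hlt
  have : 0 < ‖P u - P w‖ := (norm_nonneg _).trans_lt hlt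
  nlinarith

variable [CompleteSpace F] [FiniteDimensional ℝ F]

theorem exists_isProxMap {Y : Set F} (hne : Y.Nonempty) (hclosed : IsClosed Y)
    (hconv : Convex ℝ Y) {r : F → ℝ} (hLip : LocallyLipschitz r) (hr : ConvexOn ℝ univ r)
    {η : ℝ} (hη : 0 < η) : ∃ P, IsProxMap Y r η P := by
  suffices h : ∀ u, ∃ p ∈ Y, ∀ v ∈ Y, inner ℝ (η⁻¹ • (u - p)) (v - p) ≤ r v - r p by
    choose P h1 h2 using h
    exact ⟨P, h1, h2⟩
  intro u
  obtain ⟨d, hd⟩ := (isClosedField_limitingGradients hLip).nonempty u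
  obtain ⟨v₀, hv₀⟩ := hne
  have hcont := hLip.continuous
  -- A subgradient at `u` bounds `r` below by an affine function, which the quadratic term
  -- dominates.
  have hco : Tendsto (fun v => r v + 1 / (2 * η) * ‖v - u‖ ^ 2) (cocompact F) atTop := by
    have hn : Tendsto (fun v : F => ‖v - u‖) (cocompact F) atTop := by
      simpa [dist_eq_norm] using tendsto_dist_right_cocompact_atTop u
    have h1 : Tendsto (fun t : ℝ => t * (1 / (2 * η) * t - ‖d‖)) atTop atTop :=
      tendsto_id.atTop_mul_atTop₀ (tendsto_atTop_add_const_right _ _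
        (tendsto_id.const_mul_atTop (by positivity)))
    refine tendsto_atTop_mono (fun v => ?_) (tendsto_atTop_add_const_left _ (r u) (h1.comp hn))
    have h2 := inner_sub_le_of_mem_limitingGradients hr hcont hd v
    have h3 := neg_le_of_abs_le (abs_real_inner_le_norm d (v - u))
    simp only [Function.comp_apply]
    nlinarith
  obtain ⟨p, hp, hmin⟩ := ContinuousOn.exists_isMinOn'
    (f := fun v => r v + 1 / (2 * η) * ‖v - u‖ ^ 2) (by fun_prop) hclosed hv₀
    ((hco.eventually_ge_atTop _).filter_mono inf_le_left)
  refine ⟨p, hp, fun v hv => ?_⟩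
  have key := nonneg_of_forall_add_sq_nonneg
    (A := r v - r p - inner ℝ (η⁻¹ • (u - p)) (v - p)) (B := 1 / (2 * η) * ‖v - p‖ ^ 2) ?_
  · linarith
  intro s hs
  have h1 := hmin (hconv.add_smul_sub_mem hp hv ⟨hs.1.le, hs.2.le⟩)
  simp only [mem_ofPred_eq] at h1
  have h2 := hr.2 (mem_univ p) (mem_univ v) (sub_nonneg.2 hs.2.le) hs.1.le (by ring)
  have e : (1 - s) • p + s • v = p + s • (v - p) := by module
  rw [e] at h2
  simp only [smul_eq_mul] at h2
  have e2 : p + s • (v - p) - u = s • (v - p) - (u - p) := by abel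
  rw [e2, norm_sub_sq_real (s • (v - p)), norm_smul, inner_smul_left, norm_sub_rev p u, real_inner_comm,
    Real.norm_of_nonneg hs.1.le] at h1
  simp only [conj_trivial] at h1
  rw [inner_smul_left]
  simp only [map_inv₀, conj_trivial]
  have e3 : 1 / (2 * η) * ((s * ‖v - p‖) ^ 2 - 2 * (s * inner ℝ (u - p) (v - p)) + ‖u - p‖ ^ 2) =
      s ^ 2 * (1 / (2 * η) * ‖v - p‖ ^ 2) - s * (η⁻¹ * inner ℝ (u - p) (v - p))
        + 1 / (2 * η) * ‖u - p‖ ^ 2 := by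
    field_simp
  rw [e3] at h1
  linarith

end Prox

/-! ### The proximal argmax and the envelope in terms of the proximal map. -/

section ProxArgmax

variable {E F : Type*} [NormedAddCommGroup F] [InnerProductSpace ℝ F] [CompleteSpace F]

/-- Quadratic decay away from the proximal point, obtained by completing the square in the
variational inequality; it gives existence and uniqueness of the maximizer together. -/
theorem IsProxMap.proxObjective_le {Y : Set F} {r₂ : F → ℝ} {η : ℝ} {P : F → F} (hη : 0 < η)
    (hP : IsProxMap Y r₂ η P) (f : E → F → ℝ) (x : E) (y : F) {v : F} (hv : v ∈ Y) :
    proxObjective f r₂ η x y v ≤ proxObjective f r₂ η x y (P (y + η • gradY f x y))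
      - 1 / (2 * η) * ‖v - P (y + η • gradY f x y)‖ ^ 2 := by
  have h := hP.le (y + η • gradY f x y) v hv
  set g := gradY f x y
  set p := P (y + η • g)
  unfold proxObjective
  have e1 : inner ℝ (η⁻¹ • (y + η • g - p)) (v - p) =
      η⁻¹ * inner ℝ (y - p) (v - p) + inner ℝ g (v - p) := by
    have : η⁻¹ • (y + η • g - p) = η⁻¹ • (y - p) + g := by
      rw [show y + η • g - p = (y - p) + η • g by abel, smul_add, smul_smul,
        inv_mul_cancel₀ hη.ne', one_smul]
    rw [this, inner_add_left, inner_smul_left]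
    simp
  have e2 : v - y = (v - p) - (y - p) := by abel
  have e3 : ‖v - y‖ ^ 2 = ‖v - p‖ ^ 2 - 2 * inner ℝ (y - p) (v - p) + ‖p - y‖ ^ 2 := by
    rw [e2, norm_sub_sq_real, real_inner_comm, norm_sub_rev p y]
  have e4 : inner ℝ g (v - y) = inner ℝ g (v - p) + inner ℝ g (p - y) := by
    rw [← inner_add_right]
    congr 1
    abel
  have e5 : 1 / (2 * η) * (‖v - p‖ ^ 2 - 2 * inner ℝ (y - p) (v - p) + ‖p - y‖ ^ 2) =
      1 / (2 * η) * ‖v - p‖ ^ 2 - η⁻¹ * inner ℝ (y - p) (v - p) + 1 / (2 * η) * ‖p - y‖ ^ 2 := by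
    field_simp
  rw [e1] at h
  rw [e3, e4, e5]
  linarith

theorem IsProxMap.proxArgmax_eq {Y : Set F} {r₂ : F → ℝ} {η : ℝ} {P : F → F} (hη : 0 < η)
    (hP : IsProxMap Y r₂ η P) (f : E → F → ℝ) (x : E) (y : F) :
    proxArgmax Y f r₂ η x y = {P (y + η • gradY f x y)} := by
  ext v
  rw [mem_singleton_iff]
  constructor
  · rintro ⟨hv, hmax⟩
    have h1 := hP.proxObjective_le hη f x y hv
    have h2 : proxObjective f r₂ η x y (P (y + η • gradY f x y)) ≤ proxObjective f r₂ η x y v :=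
      hmax (hP.mem _)
    have h3 : 1 / (2 * η) * ‖v - P (y + η • gradY f x y)‖ ^ 2 ≤ 0 := by linarith
    have h4 : ‖v - P (y + η • gradY f x y)‖ ^ 2 ≤ 0 := by
      by_contra! hcon
      have : 0 < 1 / (2 * η) * ‖v - P (y + η • gradY f x y)‖ ^ 2 := by positivity
      linarith
    have h5 : ‖v - P (y + η • gradY f x y)‖ = 0 := by
      have := sq_nonneg ‖v - P (y + η • gradY f x y)‖
      exact pow_eq_zero_iff two_ne_zero |>.1 (le_antisymm h4 this)
    exact sub_eq_zero.1 (norm_eq_zero.1 h5)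
  · rintro rfl
    refine ⟨hP.mem _, fun v hv => ?_⟩
    have h1 := hP.proxObjective_le hη f x y hv
    have : 0 ≤ 1 / (2 * η) * ‖v - P (y + η • gradY f x y)‖ ^ 2 := by positivity
    simp only [mem_ofPred_eq]
    linarith

theorem IsProxMap.proxResidual_eq {Y : Set F} {r₂ : F → ℝ} {η : ℝ} {P : F → F} (hη : 0 < η)
    (hP : IsProxMap Y r₂ η P) (f : E → F → ℝ) (x : E) (y : F) :
    proxResidual Y f r₂ η x y = {η⁻¹ • (P (y + η • gradY f x y) - y)} := by
  rw [proxResidual, hP.proxArgmax_eq hη, image_singleton]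

theorem IsProxMap.envelope_eq {Y : Set F} {r₂ : F → ℝ} {η : ℝ} {P : F → F} (hη : 0 < η)
    (hP : IsProxMap Y r₂ η P) (f : E → F → ℝ) (x : E) (y : F) :
    envelope Y f r₂ η x y = proxObjective f r₂ η x y (P (y + η • gradY f x y)) := by
  have hmem : P (y + η • gradY f x y) ∈ proxArgmax Y f r₂ η x y := by
    rw [hP.proxArgmax_eq hη]
    rfl
  refine IsGreatest.csSup_eq ⟨mem_image_of_mem _ hmem.1, ?_⟩
  rintro _ ⟨v, hv, rfl⟩
  exact hmem.2 hv

end ProxArgmax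

/-! ### The descent-ascent field and the first-order minimax points -/

section NormalCone

variable {E : Type*} [NormedAddCommGroup E] [InnerProductSpace ℝ E]

theorem isClosed_graph_normalCone {C : Set E} (hC : IsClosed C) :
    IsClosed {q : E × E | q.2 ∈ normalCone C q.1} := by
  have : {q : E × E | q.2 ∈ normalCone C q.1} =
      {q : E × E | q.1 ∈ C} ∩ ⋂ x' ∈ C, {q : E × E | inner ℝ q.2 (x' - q.1) ≤ 0} := by
    ext q
    simp [normalCone]
  rw [this]
  refine (hC.preimage continuous_fst).inter (isClosed_biInter fun x' _ => ?_)
  exact isClosed_le (continuous_snd.inner (continuous_const.sub continuous_fst)) continuous_const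

theorem zero_mem_normalCone {C : Set E} {x : E} (hx : x ∈ C) : (0 : E) ∈ normalCone C x :=
  ⟨hx, fun x' _ => by simp⟩

theorem convex_normalCone (C : Set E) (x : E) : Convex ℝ (normalCone C x) := by
  intro a ha b hb p q hp hq _
  refine ⟨ha.1, fun x' hx' => ?_⟩
  rw [inner_add_left, inner_smul_left, inner_smul_left]
  simp only [conj_trivial]
  have h1 := mul_nonpos_of_nonneg_of_nonpos hp (ha.2 x' hx')
  have h2 := mul_nonpos_of_nonneg_of_nonpos hq (hb.2 x' hx')
  linarith

end NormalCone

section Kappa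

variable {E F : Type*} [NormedAddCommGroup E] [InnerProductSpace ℝ E] [CompleteSpace E]
  [FiniteDimensional ℝ E]

/-- The supremum is attained by compactness. Trading it for a witness `l` lets the bound on `ν`
enter closed-graph arguments as one more projected variable. -/
theorem le_kappa_iff (f : E → F → ℝ) {r₁ : E → ℝ} (hr₁ : LocallyLipschitz r₁) (x : E) (y : F)
    (c : ℝ) : c ≤ kappa f r₁ x y ↔ ∃ l ∈ clarkeSubdiff r₁ x, c ≤ 2 * ‖l + gradX f x y‖ := by
  have hK := isClosedField_clarkeSubdiff hr₁
  obtain ⟨m, hm, hmax⟩ := (hK.isCompact x).exists_isMaxOn (hK.nonempty x)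
    (f := fun l => ‖l + gradX f x y‖) (by fun_prop)
  have hgreat : IsGreatest ((fun l => ‖l + gradX f x y‖) '' clarkeSubdiff r₁ x)
      ‖m + gradX f x y‖ := by
    refine ⟨mem_image_of_mem _ hm, ?_⟩
    rintro _ ⟨l, hl, rfl⟩
    exact hmax hl
  rw [kappa, hgreat.csSup_eq]
  constructor
  · exact fun h => ⟨m, hm, h⟩
  · rintro ⟨l, hl, h⟩
    have := hgreat.2 (mem_image_of_mem _ hl)
    linarith

end Kappa

section Field

variable {E F : Type*} [NormedAddCommGroup E] [InnerProductSpace ℝ E] [CompleteSpace E]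
  [NormedAddCommGroup F] [InnerProductSpace ℝ F] [CompleteSpace F]

/-- The product carries the sup norm, which costs a factor `√2`, rounded up to `2`. -/
theorem lipschitzWith_gradX {f : E → F → ℝ} {L : NNReal}
    (h : ∀ x y x' y', ‖gradX f x y - gradX f x' y'‖ ^ 2 + ‖gradY f x y - gradY f x' y'‖ ^ 2
      ≤ (L : ℝ) ^ 2 * (‖x - x'‖ ^ 2 + ‖y - y'‖ ^ 2)) :
    LipschitzWith (2 * L) fun z : E × F => gradX f z.1 z.2 := by
  refine LipschitzWith.of_dist_le_mul fun z w => ?_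
  rw [dist_eq_norm, dist_eq_norm]
  have h1 : ‖z.1 - w.1‖ ≤ ‖z - w‖ := norm_fst_le (z - w)
  have h2 : ‖z.2 - w.2‖ ≤ ‖z - w‖ := norm_snd_le (z - w)
  refine abs_le_of_sq_le_sq' ?_ (by positivity) |>.2
  push_cast
  calc _ ≤ (L : ℝ) ^ 2 * (‖z.1 - w.1‖ ^ 2 + ‖z.2 - w.2‖ ^ 2) := by
        linarith [h z.1 z.2 w.1 w.2, sq_nonneg ‖gradY f z.1 z.2 - gradY f w.1 w.2‖]
    _ ≤ (L : ℝ) ^ 2 * (‖z - w‖ ^ 2 + ‖z - w‖ ^ 2) := by gcongr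
    _ ≤ _ := by nlinarith [mul_nonneg (sq_nonneg (L : ℝ)) (sq_nonneg ‖z - w‖)]

theorem lipschitzWith_gradY {f : E → F → ℝ} {L : NNReal}
    (h : ∀ x y x' y', ‖gradX f x y - gradX f x' y'‖ ^ 2 + ‖gradY f x y - gradY f x' y'‖ ^ 2
      ≤ (L : ℝ) ^ 2 * (‖x - x'‖ ^ 2 + ‖y - y'‖ ^ 2)) :
    LipschitzWith (2 * L) fun z : E × F => gradY f z.1 z.2 := by
  refine LipschitzWith.of_dist_le_mul fun z w => ?_
  rw [dist_eq_norm, dist_eq_norm]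
  have h1 : ‖z.1 - w.1‖ ≤ ‖z - w‖ := norm_fst_le (z - w)
  have h2 : ‖z.2 - w.2‖ ≤ ‖z - w‖ := norm_snd_le (z - w)
  refine abs_le_of_sq_le_sq' ?_ (by positivity) |>.2
  push_cast
  calc _ ≤ (L : ℝ) ^ 2 * (‖z.1 - w.1‖ ^ 2 + ‖z.2 - w.2‖ ^ 2) := by
        linarith [h z.1 z.2 w.1 w.2, sq_nonneg ‖gradX f z.1 z.2 - gradX f w.1 w.2‖]
    _ ≤ (L : ℝ) ^ 2 * (‖z - w‖ ^ 2 + ‖z - w‖ ^ 2) := by gcongr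
    _ ≤ _ := by nlinarith [mul_nonneg (sq_nonneg (L : ℝ)) (sq_nonneg ‖z - w‖)]

theorem IsProxMap.mem_sgdaField_iff {X : Set E} {Y : Set F} {f : E → F → ℝ} {r₁ : E → ℝ}
    {r₂ : F → ℝ} {η θ : ℝ} (hη : 0 < η) {P : F → F} (hP : IsProxMap Y r₂ η P) (z w : E × F) :
    w ∈ sgdaField X Y f r₁ r₂ η θ z ↔
      (∃ l ∈ clarkeSubdiff r₁ z.1, ∃ ν ∈ normalCone X z.1,
        ‖ν‖ ≤ kappa f r₁ z.1 z.2 ∧ w.1 = l + gradX f z.1 z.2 + ν) ∧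
      w.2 = -(θ • (η⁻¹ • (P (z.2 + η • gradY f z.1 z.2) - z.2))) := by
  simp only [sgdaField, mem_ofPred_eq, hP.proxResidual_eq hη, mem_singleton_iff,
    exists_eq_left]

variable [FiniteDimensional ℝ E]

theorem IsProxMap.isAdmissibleField {X : Set E} {Y : Set F} (hX : IsClosed X) (hY : IsClosed Y)
    {f : E → F → ℝ} (hgX : Continuous fun z : E × F => gradX f z.1 z.2)
    (hgY : Continuous fun z : E × F => gradY f z.1 z.2) {r₁ : E → ℝ}
    (hr₁ : LocallyLipschitz r₁) {r₂ : F → ℝ} {η : ℝ} (θ : ℝ) (hη : 0 < η) {P : F → F}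
    (hP : IsProxMap Y r₂ η P) :
    IsAdmissibleField (X ×ˢ Y) (sgdaField X Y f r₁ r₂ η θ) := by
  have hK := isClosedField_clarkeSubdiff hr₁
  have hPc : Continuous P := (hP.lipschitzWith hη).continuous
  have hR : Continuous fun z : E × F =>
      -(θ • (η⁻¹ • (P (z.2 + η • gradY f z.1 z.2) - z.2))) := by fun_prop
  refine ⟨fun z _ => ?_, fun z hz => ?_, fun z _ => ?_, ?_⟩
  · obtain ⟨B, hB, hbd⟩ := hK.locallyBounded z.1 (mem_univ _)
    rw [nhdsWithin_univ] at hB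
    obtain ⟨M, hM⟩ := isBounded_iff_forall_norm_le.1 hbd
    refine ⟨{u | u.1 ∈ B ∧ ‖gradX f u.1 u.2‖ < ‖gradX f z.1 z.2‖ + 1 ∧
      ‖-(θ • (η⁻¹ • (P (u.2 + η • gradY f u.1 u.2) - u.2)))‖ <
        ‖-(θ • (η⁻¹ • (P (z.2 + η • gradY f z.1 z.2) - z.2)))‖ + 1}, ?_, ?_⟩
    · refine nhdsWithin_le_nhds (inter_mem (continuous_fst.continuousAt hB) (inter_mem ?_ ?_))
      · exact hgX.norm.continuousAt.eventually_lt continuousAt_const (lt_add_one _)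
      · exact hR.norm.continuousAt.eventually_lt continuousAt_const (lt_add_one _)
    · set G := ‖gradX f z.1 z.2‖ + 1
      set R := ‖-(θ • (η⁻¹ • (P (z.2 + η • gradY f z.1 z.2) - z.2)))‖ + 1
      -- `M + G` bounds `l + ∇ₓf`, and the bound by `kappa` allows `ν` twice as much.
      refine isBounded_iff_forall_norm_le.2 ⟨max (3 * (M + G)) R, fun w hw => ?_⟩
      obtain ⟨u, ⟨hu1, hu2, hu3⟩, hwu⟩ := mem_iUnion₂.1 hw
      obtain ⟨⟨l, hl, ν, -, hν, hw1⟩, hw2⟩ := (hP.mem_sgdaField_iff hη u w).1 hwu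
      obtain ⟨l', hl', hν⟩ := (le_kappa_iff f hr₁ _ _ _).1 hν
      have hlM := hM l (mem_biUnion hu1 hl)
      have hlM' := hM l' (mem_biUnion hu1 hl')
      refine norm_prod_le_iff.2 ⟨le_max_of_le_left ?_, le_max_of_le_right ?_⟩
      · rw [hw1]
        have h1 := norm_add_le (l + gradX f u.1 u.2) ν
        have h2 := norm_add_le l (gradX f u.1 u.2)
        have h3 := norm_add_le l' (gradX f u.1 u.2)
        linarith
      · rw [hw2]
        exact hu3.le
  · obtain ⟨l, hl⟩ := hK.nonempty z.1
    refine ⟨(l + gradX f z.1 z.2 + 0, _), (hP.mem_sgdaField_iff hη z _).2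
      ⟨⟨l, hl, 0, zero_mem_normalCone hz.1, ?_, rfl⟩, rfl⟩⟩
    exact (le_kappa_iff f hr₁ _ _ _).2 ⟨l, hl, by rw [norm_zero]; positivity⟩
  · intro a ha b hb p q hp hq hpq
    rw [hP.mem_sgdaField_iff hη] at ha hb ⊢
    obtain ⟨⟨l, hl, ν, hν, hνκ, h1⟩, h2⟩ := ha
    obtain ⟨⟨l', hl', ν', hν', hνκ', h1'⟩, h2'⟩ := hb
    refine ⟨⟨p • l + q • l', convex_convexHull ℝ _ hl hl' hp hq hpq, p • ν + q • ν',
      convex_normalCone X _ hν hν' hp hq hpq, ?_, ?_⟩, ?_⟩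
    · have := (convex_closedBall (0 : E) (kappa f r₁ z.1 z.2))
        (mem_closedBall_zero_iff.2 hνκ) (mem_closedBall_zero_iff.2 hνκ') hp hq hpq
      exact mem_closedBall_zero_iff.1 this
    · rw [Prod.fst_add, Prod.smul_fst, Prod.smul_fst, h1, h1']
      have : gradX f z.1 z.2 = (p + q) • gradX f z.1 z.2 := by rw [hpq, one_smul]
      nth_rw 3 [this]
      module
    · rw [Prod.snd_add, Prod.smul_snd, Prod.smul_snd, h2, h2', ← add_smul, hpq, one_smul]
  -- Two Clarke subgradients are projected out: `l` from the field itself and `l'` witnessing the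
  -- bound by `kappa`; `ν` is determined by the rest.
  · have heq : {q : (E × F) × E × F | q.1 ∈ X ×ˢ Y ∧ q.2 ∈ sgdaField X Y f r₁ r₂ η θ q.1} =
        {q : (E × F) × E × F | ∃ l ∈ clarkeSubdiff r₁ q.1.1,
          (q, l) ∈ {s : ((E × F) × E × F) × E | ∃ l' ∈ clarkeSubdiff r₁ s.1.1.1,
            (s, l') ∈ {t : (((E × F) × E × F) × E) × E |
              t.1.1.1 ∈ X ×ˢ Y ∧
              (t.1.1.1.1, t.1.1.2.1 - t.1.2 - gradX f t.1.1.1.1 t.1.1.1.2) ∈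
                {q : E × E | q.2 ∈ normalCone X q.1} ∧
              ‖t.1.1.2.1 - t.1.2 - gradX f t.1.1.1.1 t.1.1.1.2‖ ≤
                2 * ‖t.2 + gradX f t.1.1.1.1 t.1.1.1.2‖ ∧
              t.1.1.2.2 = -(θ • (η⁻¹ • (P (t.1.1.1.2 + η • gradY f t.1.1.1.1 t.1.1.1.2)
                - t.1.1.1.2)))}}} := by
      ext ⟨z, w⟩
      simp only [mem_ofPred_eq, hP.mem_sgdaField_iff hη]
      constructor
      · rintro ⟨hz, ⟨l, hl, ν, hν, hκ, h1⟩, h2⟩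
        obtain ⟨l', hl', hκ⟩ := (le_kappa_iff f hr₁ _ _ _).1 hκ
        have e : w.1 - l - gradX f z.1 z.2 = ν := by
          rw [h1]
          abel
        exact ⟨l, hl, l', hl', hz, by rwa [e], by rwa [e], h2⟩
      · rintro ⟨l, hl, l', hl', hz, hν, hκ, h2⟩
        exact ⟨hz, ⟨l, hl, _, hν, (le_kappa_iff f hr₁ _ _ _).2 ⟨l', hl', hκ⟩, by abel⟩, h2⟩
    rw [heq]
    refine isClosed_setOf_exists_mem hK.closedGraph hK.locallyBounded
      (a := fun q : (E × F) × E × F => q.1.1)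
      (by fun_prop) ?_
    refine isClosed_setOf_exists_mem hK.closedGraph hK.locallyBounded
      (a := fun s : ((E × F) × E × F) × E => s.1.1.1)
      (by fun_prop) ?_
    have hg : Continuous fun t : (((E × F) × E × F) × E) × E =>
        gradX f t.1.1.1.1 t.1.1.1.2 :=
      hgX.comp (f := fun t : (((E × F) × E × F) × E) × E => t.1.1.1) (by fun_prop)
    refine ((hX.prod hY).preimage (f := fun t : (((E × F) × E × F) × E) × E => t.1.1.1)
      (by fun_prop)).inter (IsClosed.inter ?_ (IsClosed.inter ?_ ?_))
    · exact (isClosed_graph_normalCone hX).preimage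
        (f := fun t : (((E × F) × E × F) × E) × E =>
          (t.1.1.1.1, t.1.1.2.1 - t.1.2 - gradX f t.1.1.1.1 t.1.1.1.2)) (by fun_prop)
    · have h1 : Continuous fun t : (((E × F) × E × F) × E) × E =>
          ‖t.1.1.2.1 - t.1.2 - gradX f t.1.1.1.1 t.1.1.1.2‖ := by fun_prop
      have h2 : Continuous fun t : (((E × F) × E × F) × E) × E =>
          2 * ‖t.2 + gradX f t.1.1.1.1 t.1.1.1.2‖ := by fun_prop
      exact isClosed_le h1 h2
    · exact isClosed_eq (by fun_prop)
        (hR.comp (f := fun t : (((E × F) × E × F) × E) × E => t.1.1.1) (by fun_prop))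

variable [FiniteDimensional ℝ F]

theorem isClosed_firstOrderMinimaxPoints {X : Set E} {Y : Set F} (hX : IsClosed X)
    (hY : IsClosed Y) {f : E → F → ℝ} (hgX : Continuous fun z : E × F => gradX f z.1 z.2)
    (hgY : Continuous fun z : E × F => gradY f z.1 z.2) {r₁ : E → ℝ}
    (hr₁ : LocallyLipschitz r₁) {r₂ : F → ℝ} (hr₂ : LocallyLipschitz r₂) :
    IsClosed (firstOrderMinimaxPoints X Y f r₁ r₂) := by
  have hK₁ := isClosedField_clarkeSubdiff hr₁
  have hK₂ := isClosedField_clarkeSubdiff hr₂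
  have heq : firstOrderMinimaxPoints X Y f r₁ r₂ =
      {z : E × F | ∃ l ∈ clarkeSubdiff r₁ z.1, (z, l) ∈ {q : (E × F) × E |
        (q.1.1, -(gradX f q.1.1 q.1.2 + q.2)) ∈ {q : E × E | q.2 ∈ normalCone X q.1}}} ∩
      {z : E × F | ∃ d ∈ clarkeSubdiff r₂ z.2, (z, d) ∈ {q : (E × F) × F |
        (q.1.2, -(-gradY f q.1.1 q.1.2 + q.2)) ∈ {q : F × F | q.2 ∈ normalCone Y q.1}}} := by
    ext z
    simp only [firstOrderMinimaxPoints, mem_inter_iff, mem_ofPred_eq]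
    constructor
    · rintro ⟨-, -, ⟨l, hl, ν, hν, h1⟩, d, hd, ν', hν', h2⟩
      refine ⟨⟨l, hl, ?_⟩, d, hd, ?_⟩
      · rwa [neg_eq_of_add_eq_zero_right h1.symm]
      · rwa [neg_eq_of_add_eq_zero_right h2.symm]
    · rintro ⟨⟨l, hl, hν⟩, d, hd, hν'⟩
      exact ⟨hν.1, hν'.1, ⟨l, hl, _, hν, by abel⟩, d, hd, _, hν', by abel⟩
  rw [heq]
  have hg₁ : Continuous fun q : (E × F) × E => gradX f q.1.1 q.1.2 := hgX.comp continuous_fst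
  have hg₂ : Continuous fun q : (E × F) × F => gradY f q.1.1 q.1.2 := hgY.comp continuous_fst
  refine IsClosed.inter ?_ ?_
  · refine isClosed_setOf_exists_mem hK₁.closedGraph hK₁.locallyBounded continuous_fst ?_
    exact (isClosed_graph_normalCone hX).preimage
      (f := fun q : (E × F) × E => (q.1.1, -(gradX f q.1.1 q.1.2 + q.2))) (by fun_prop)
  · refine isClosed_setOf_exists_mem hK₂.closedGraph hK₂.locallyBounded continuous_snd ?_
    exact (isClosed_graph_normalCone hY).preimage
      (f := fun q : (E × F) × F => (q.1.2, -(-gradY f q.1.1 q.1.2 + q.2))) (by fun_prop)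

end Field

section Stationary

variable {E F : Type*} [NormedAddCommGroup E] [InnerProductSpace ℝ E] [CompleteSpace E]
  [NormedAddCommGroup F] [InnerProductSpace ℝ F] [CompleteSpace F] [FiniteDimensional ℝ F]

theorem IsProxMap.mem_firstOrderMinimaxPoints {X : Set E} {Y : Set F} (hY : Convex ℝ Y)
    {f : E → F → ℝ} {r₁ : E → ℝ} {r₂ : F → ℝ} (hr₂Lip : LocallyLipschitz r₂)
    (hr₂ : ConvexOn ℝ univ r₂) {η : ℝ} (hη : 0 < η) {P : F → F} (hP : IsProxMap Y r₂ η P)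
    {z : E × F} (hz : z ∈ X ×ˢ Y)
    (hx : ∃ l ∈ clarkeSubdiff r₁ z.1, ∃ ν ∈ normalCone X z.1, 0 = gradX f z.1 z.2 + l + ν)
    (hy : P (z.2 + η • gradY f z.1 z.2) = z.2) :
    z ∈ firstOrderMinimaxPoints X Y f r₁ r₂ := by
  refine ⟨hz.1, hz.2, hx, exists_mem_clarkeSubdiff_add_normalCone hr₂Lip hr₂ hY hz.2 ?_⟩
  intro v hv
  have := hP.le (z.2 + η • gradY f z.1 z.2) v hv
  rwa [hy, add_sub_cancel_left, smul_smul, inv_mul_cancel₀ hη.ne', one_smul] at this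

end Stationary

/-! ### Derivatives along curves -/

section Curves

variable {E F : Type*} [NormedAddCommGroup E] [NormedSpace ℝ E] [NormedAddCommGroup F]

section NormedSpace

variable [NormedSpace ℝ F]

theorem _root_.HasDerivAt.fst_prod {γ : ℝ → E × F} {v : E × F} {t : ℝ} (h : HasDerivAt γ v t) :
    HasDerivAt (fun s => (γ s).1) v.1 t :=
  (ContinuousLinearMap.fst ℝ E F).hasFDerivAt.comp_hasDerivAt t h

theorem _root_.HasDerivAt.snd_prod {γ : ℝ → E × F} {v : E × F} {t : ℝ} (h : HasDerivAt γ v t) :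
    HasDerivAt (fun s => (γ s).2) v.2 t :=
  (ContinuousLinearMap.snd ℝ E F).hasFDerivAt.comp_hasDerivAt t h

end NormedSpace

variable [InnerProductSpace ℝ F]

/-- `⟨ν, x s⟩` has a two-sided local maximum at `t`, whence equality and not just an inequality. -/
theorem inner_deriv_eq_zero_of_mem_normalCone {X : Set F} {x : ℝ → F} {v ν : F} {t : ℝ}
    (hx : HasDerivAt x v t) (hX : ∀ᶠ s in 𝓝 t, x s ∈ X) (hν : ν ∈ normalCone X (x t)) :
    inner ℝ ν v = 0 := by
  have hd : HasDerivAt (fun s => inner ℝ ν (x s)) (inner ℝ ν v) t := by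
    simpa using (hasDerivAt_const t ν).inner ℝ hx
  refine IsLocalMax.hasDerivAt_eq_zero ?_ hd
  filter_upwards [hX] with s hs
  have := hν.2 _ hs
  rw [inner_sub_right] at this
  linarith

/-- `r (y s) - ⟨d, y s⟩` is minimal at `s = t`. -/
theorem hasDerivAt_eq_inner_of_subgradient {r : F → ℝ} {y : ℝ → F} {v d : F} {t ρ : ℝ}
    (hy : HasDerivAt y v t) (hr : HasDerivAt (fun s => r (y s)) ρ t)
    (hd : ∀ w, inner ℝ d (w - y t) ≤ r w - r (y t)) : ρ = inner ℝ d v := by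
  have h : HasDerivAt (fun s => r (y s) - inner ℝ d (y s)) (ρ - inner ℝ d v) t := by
    simpa using hr.fun_sub ((hasDerivAt_const t d).inner ℝ hy)
  refine sub_eq_zero.1 (IsLocalMin.hasDerivAt_eq_zero ?_ h)
  refine Eventually.of_forall fun s => ?_
  have := hd (y s)
  rw [inner_sub_right] at this
  simp only
  linarith

variable [CompleteSpace F]

theorem inner_gradY_add_smul_sub_le {f : E → F → ℝ}
    (hf : Differentiable ℝ fun z : E × F => f z.1 z.2) {Y : Set F} {μ : ℝ} (hμ : 0 ≤ μ) {x : E}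
    (hc : StrongConcaveOn Y μ (f x)) {y R : F} {s : ℝ} (hs : 0 ≤ s) (hy : y ∈ Y)
    (hyR : y + s • R ∈ Y) :
    inner ℝ (gradY f x (y + s • R) - gradY f x y) R ≤ -μ * s * ‖R‖ ^ 2 := by
  rcases hs.eq_or_lt with rfl | hs
  · simp
  have hd : Differentiable ℝ (f x) := fun y =>
    DifferentiableAt.comp (g := fun z : E × F => f z.1 z.2) y (hf (x, y))
      (hasFDerivAt_prodMk_right x y).differentiableAt
  have h := inner_gradient_sub_le_of_strongConcaveOn hd hc hμ hy hyR
  rw [add_sub_cancel_left, inner_smul_right, norm_smul, Real.norm_of_nonneg hs.le] at h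
  refine le_of_mul_le_mul_left (h.trans (le_of_eq ?_)) hs
  ring

end Curves

section Curves

variable {E F : Type*} [NormedAddCommGroup E] [InnerProductSpace ℝ E] [CompleteSpace E]
  [NormedAddCommGroup F] [InnerProductSpace ℝ F] [CompleteSpace F]

theorem hasDerivAt_comp_uncurried {f : E → F → ℝ}
    (hf : Differentiable ℝ fun z : E × F => f z.1 z.2) {γ : ℝ → E × F} {v : E × F} {t : ℝ}
    (hγ : HasDerivAt γ v t) :
    HasDerivAt (fun s => f (γ s).1 (γ s).2)
      (inner ℝ (gradX f (γ t).1 (γ t).2) v.1 + inner ℝ (gradY f (γ t).1 (γ t).2) v.2) t := by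
  have hz := (hf (γ t)).hasFDerivAt
  have h1 : HasFDerivAt (fun x => f x (γ t).2)
      ((fderiv ℝ (fun z : E × F => f z.1 z.2) (γ t)).comp (ContinuousLinearMap.inl ℝ E F))
      (γ t).1 :=
    HasFDerivAt.comp (g := fun z : E × F => f z.1 z.2) (f := fun x => (x, (γ t).2)) (γ t).1 hz
      (hasFDerivAt_prodMk_left _ _)
  have h2 : HasFDerivAt (fun y => f (γ t).1 y)
      ((fderiv ℝ (fun z : E × F => f z.1 z.2) (γ t)).comp (ContinuousLinearMap.inr ℝ E F))
      (γ t).2 :=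
    HasFDerivAt.comp (g := fun z : E × F => f z.1 z.2) (f := fun y => ((γ t).1, y)) (γ t).2 hz
      (hasFDerivAt_prodMk_right _ _)
  have e : inner ℝ (gradX f (γ t).1 (γ t).2) v.1 + inner ℝ (gradY f (γ t).1 (γ t).2) v.2 =
      fderiv ℝ (fun z : E × F => f z.1 z.2) (γ t) v := by
    rw [gradX, gradY, gradient, gradient, InnerProductSpace.toDual_symm_apply,
      InnerProductSpace.toDual_symm_apply, h1.fderiv, h2.fderiv]
    simp [← map_add]
  rw [e]
  exact hz.comp_hasDerivAt t hγ

/-- Replaces Hessian bounds by increments. The point `(x t, y t + sθR)` is inserted between `γ t`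
and `γ (t + s)`: strong concavity controls the first move, the Lipschitz bound the second, where the
`y` displacement is `o(s)`. -/
theorem inner_deriv_gradY_le {f : E → F → ℝ} {L : NNReal}
    (hL : ∀ x y x' y', ‖gradX f x y - gradX f x' y'‖ ^ 2 + ‖gradY f x y - gradY f x' y'‖ ^ 2
      ≤ (L : ℝ) ^ 2 * (‖x - x'‖ ^ 2 + ‖y - y'‖ ^ 2))
    (hf : Differentiable ℝ fun z : E × F => f z.1 z.2) {Y : Set F} (hY : Convex ℝ Y) {μ : ℝ}
    (hμ : 0 ≤ μ) {γ : ℝ → E × F} {v : E × F} {t : ℝ} (hγ : HasDerivAt γ v t)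
    (hc : StrongConcaveOn Y μ (f (γ t).1)) {R g' : F} {k θ : ℝ} (hk : 0 < k) (hθ : 0 ≤ θ)
    (hy : (γ t).2 ∈ Y) (hyR : (γ t).2 + k • R ∈ Y) (hv : v.2 = θ • R)
    (hg : HasDerivAt (fun s => gradY f (γ s).1 (γ s).2) g' t) :
    inner ℝ g' R ≤ L * ‖v.1‖ * ‖R‖ - μ * θ * ‖R‖ ^ 2 := by
  have hx := hγ.fst_prod.tendsto_slope_zero_right
  have hy' := hγ.snd_prod.tendsto_slope_zero_right
  have hg' := hg.tendsto_slope_zero_right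
  have hyv : Tendsto (fun s : ℝ => s⁻¹ • ((γ (t + s)).2 - (γ t).2) - θ • R) (𝓝[>] 0) (𝓝 0) := by
    simpa [hv] using hy'.sub_const (θ • R)
  have hlhs := hg'.inner (𝕜 := ℝ) (tendsto_const_nhds (x := R))
  have hrhs := ((hx.norm.add hyv.norm).const_mul (L : ℝ)).mul_const ‖R‖ |>.sub_const
    (μ * θ * ‖R‖ ^ 2)
  rw [norm_zero, add_zero] at hrhs
  refine le_of_tendsto_of_tendsto hlhs hrhs ?_
  have hsmall : ∀ᶠ s in 𝓝[>] (0 : ℝ), s * θ < k := by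
    refine nhdsWithin_le_nhds (ContinuousAt.eventually_lt (f := fun s : ℝ => s * θ)
      (by fun_prop) continuousAt_const ?_)
    simpa using hk
  filter_upwards [hsmall, self_mem_nhdsWithin] with s hs hs0
  have hs0 : 0 < s := hs0
  -- Strong concavity is available only on `Y`; for small `s` the point lies on the segment from `y
  -- t` to `y t + k R`.
  have hmem : (γ t).2 + (s * θ) • R ∈ Y := by
    have := hY.add_smul_mem hy hyR (t := s * θ / k)
      ⟨by positivity, (div_le_one hk).2 hs.le⟩
    rwa [smul_smul, div_mul_cancel₀ _ hk.ne'] at this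
  have h1 := inner_gradY_add_smul_sub_le hf hμ hc (mul_nonneg hs0.le hθ) hy hmem
  set a := gradY f (γ (t + s)).1 (γ (t + s)).2
  set b := gradY f (γ t).1 ((γ t).2 + (s * θ) • R)
  set c := gradY f (γ t).1 (γ t).2
  have h2 : ‖a - b‖ ≤ L * (‖(γ (t + s)).1 - (γ t).1‖
      + ‖(γ (t + s)).2 - ((γ t).2 + (s * θ) • R)‖) := by
    refine abs_le_of_sq_le_sq' ?_ (by positivity) |>.2
    have h3 := hL (γ (t + s)).1 (γ (t + s)).2 (γ t).1 ((γ t).2 + (s * θ) • R)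
    have h4 : (L : ℝ) ^ 2 * (‖(γ (t + s)).1 - (γ t).1‖ ^ 2
        + ‖(γ (t + s)).2 - ((γ t).2 + (s * θ) • R)‖ ^ 2) ≤ (L : ℝ) ^ 2 *
        (‖(γ (t + s)).1 - (γ t).1‖ + ‖(γ (t + s)).2 - ((γ t).2 + (s * θ) • R)‖) ^ 2 := by
      gcongr
      nlinarith [mul_nonneg (norm_nonneg ((γ (t + s)).1 - (γ t).1))
        (norm_nonneg ((γ (t + s)).2 - ((γ t).2 + (s * θ) • R)))]
    rw [mul_pow]
    linarith [sq_nonneg ‖gradX f (γ (t + s)).1 (γ (t + s)).2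
      - gradX f (γ t).1 ((γ t).2 + (s * θ) • R)‖]
  have e1 : ‖s⁻¹ • ((γ (t + s)).1 - (γ t).1)‖ = s⁻¹ * ‖(γ (t + s)).1 - (γ t).1‖ := by
    rw [norm_smul, Real.norm_of_nonneg (inv_pos.2 hs0).le]
  have e2 : ‖s⁻¹ • ((γ (t + s)).2 - (γ t).2) - θ • R‖ =
      s⁻¹ * ‖(γ (t + s)).2 - ((γ t).2 + (s * θ) • R)‖ := by
    rw [← Real.norm_of_nonneg (inv_pos.2 hs0).le, ← norm_smul,
      Real.norm_of_nonneg (inv_pos.2 hs0).le, ← sub_sub, smul_sub _ _ ((s * θ) • R), smul_smul,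
      inv_mul_cancel_left₀ hs0.ne']
  have h5 : inner ℝ (a - c) R ≤ L * (‖(γ (t + s)).1 - (γ t).1‖
      + ‖(γ (t + s)).2 - ((γ t).2 + (s * θ) • R)‖) * ‖R‖ - μ * (s * θ) * ‖R‖ ^ 2 := by
    have h6 : inner ℝ (a - c) R = inner ℝ (a - b) R + inner ℝ (b - c) R := by
      rw [← inner_add_left, sub_add_sub_cancel]
    have h7 := (real_inner_le_norm (a - b) R).trans
      (mul_le_mul_of_nonneg_right h2 (norm_nonneg R))
    linarith
  rw [e1, e2, inner_smul_left]
  simp only [map_inv₀, conj_trivial]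
  have h8 := mul_le_mul_of_nonneg_left h5 (inv_pos.2 hs0).le
  refine h8.trans (le_of_eq ?_)
  field_simp

/-- With the maximizer `T` of time `t` frozen, envelope minus objective at `T` is nonnegative and
vanishes at `t`, so the two derivatives agree. -/
theorem IsProxMap.deriv_envelope_eq {Y : Set F} {r₂ : F → ℝ} {η : ℝ} {P : F → F} (hη : 0 < η)
    (hP : IsProxMap Y r₂ η P) {f : E → F → ℝ}
    (hf : Differentiable ℝ fun z : E × F => f z.1 z.2) {γ : ℝ → E × F} {v : E × F} {t e' : ℝ}
    {g' R : F} (hγ : HasDerivAt γ v t)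
    (hg : HasDerivAt (fun s => gradY f (γ s).1 (γ s).2) g' t)
    (he : HasDerivAt (fun s => envelope Y f r₂ η (γ s).1 (γ s).2) e' t)
    (hR : P ((γ t).2 + η • gradY f (γ t).1 (γ t).2) - (γ t).2 = η • R) :
    e' = inner ℝ (gradX f (γ t).1 (γ t).2) v.1 + η * inner ℝ g' R + inner ℝ R v.2 := by
  set T := P ((γ t).2 + η • gradY f (γ t).1 (γ t).2) with hT
  have hy := hγ.snd_prod
  have hTy := hy.const_sub T
  have h1 := (((hasDerivAt_comp_uncurried hf hγ).fun_add (hg.inner ℝ hTy)).sub_const (r₂ T)).fun_sub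
    (hTy.norm_sq.const_mul (1 / (2 * η)))
  have h2 := he.fun_sub h1
  have hmin := IsLocalMin.hasDerivAt_eq_zero (Eventually.of_forall fun s => ?_) h2
  · rw [hR] at hmin
    simp only [inner_neg_right, inner_smul_right, inner_smul_left, conj_trivial] at hmin
    have : 1 / (2 * η) * (2 * -(η * inner ℝ R v.2)) = -inner ℝ R v.2 := by
      field_simp
    rw [this] at hmin
    linarith
  · have e1 := hP.envelope_eq hη f (γ t).1 (γ t).2
    rw [← hT] at e1
    have e2 := hP.envelope_eq hη f (γ s).1 (γ s).2
    have e3 := hP.proxObjective_le hη f (γ s).1 (γ s).2 (hP.mem _ : T ∈ Y)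
    have e4 : 0 ≤ 1 / (2 * η) * ‖T - P ((γ s).2 + η • gradY f (γ s).1 (γ s).2)‖ ^ 2 := by
      positivity
    rw [← e2] at e3
    simp only [proxObjective] at e1 e3
    rw [e1]
    linarith

end Curves

/-! ### The Lyapunov property -/

section Penalty

variable {E F : Type*} [NormedAddCommGroup E] [NormedAddCommGroup F] [InnerProductSpace ℝ F]
  [CompleteSpace F]

theorem locallyLipschitz_penalty {Y : Set F} {f : E → F → ℝ} {r₁ : E → ℝ} {r₂ : F → ℝ}
    {η : ℝ} (α : ℝ) (he : LocallyLipschitz fun z : E × F => envelope Y f r₂ η z.1 z.2)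
    (hf : LocallyLipschitz fun z : E × F => f z.1 z.2) (hr₁ : LocallyLipschitz r₁)
    (hr₂ : LocallyLipschitz r₂) : LocallyLipschitz (penalty Y f r₁ r₂ η α) := by
  have hall := (he.prodMk hf).prodMk
    ((hr₁.comp LipschitzWith.prod_fst.locallyLipschitz).prodMk
      (hr₂.comp LipschitzWith.prod_snd.locallyLipschitz))
  have hs : LocallyLipschitz fun q : (ℝ × ℝ) × ℝ × ℝ =>
      α * q.1.1 - (α - 1) * q.1.2 + q.2.1 + (α - 1) * q.2.2 :=
    ContDiff.locallyLipschitz (𝕂 := ℝ) (by fun_prop)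
  exact hs.comp hall

/-- Supplies the almost everywhere differentiability along curves that `IsProxMap.deriv_envelope_eq`
presupposes. -/
theorem IsProxMap.locallyLipschitz_envelope {Y : Set F} {r₂ : F → ℝ} {η : ℝ} {P : F → F}
    (hη : 0 < η) (hP : IsProxMap Y r₂ η P) {f : E → F → ℝ}
    (hf : LocallyLipschitz fun z : E × F => f z.1 z.2)
    (hg : LocallyLipschitz fun z : E × F => gradY f z.1 z.2) (hr₂ : LocallyLipschitz r₂) :
    LocallyLipschitz fun z : E × F => envelope Y f r₂ η z.1 z.2 := by
  have hT : LocallyLipschitz fun z : E × F => P (z.2 + η • gradY f z.1 z.2) := by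
    have h1 : LocallyLipschitz fun q : F × F => q.1 + η • q.2 :=
      ContDiff.locallyLipschitz (𝕂 := ℝ) (by fun_prop)
    have h2 := h1.comp (LipschitzWith.prod_snd.locallyLipschitz.prodMk hg)
    exact (hP.lipschitzWith hη).locallyLipschitz.comp h2
  have hall := (hf.prodMk (hr₂.comp hT)).prodMk
    (hg.prodMk (hT.prodMk LipschitzWith.prod_snd.locallyLipschitz))
  have hs : LocallyLipschitz fun q : (ℝ × ℝ) × F × F × F =>
      q.1.1 + inner ℝ q.2.1 (q.2.2.1 - q.2.2.2) - q.1.2 - 1 / (2 * η) * ‖q.2.2.1 - q.2.2.2‖ ^ 2 := by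
    refine ContDiff.locallyLipschitz (𝕂 := ℝ) ?_
    have h1 : ContDiff ℝ 1 fun q : (ℝ × ℝ) × F × F × F => q.2.1 := by fun_prop
    have h2 : ContDiff ℝ 1 fun q : (ℝ × ℝ) × F × F × F => q.2.2.1 - q.2.2.2 := by fun_prop
    have h3 := h1.inner ℝ h2
    have h4 := h2.norm_sq ℝ
    fun_prop
  have h := hs.comp hall
  simp only [hP.envelope_eq hη, proxObjective]
  exact h

end Penalty

/-! ### Solutions remain in the state space. -/

section Invariance

theorem IsSolution.ae_Icc {V : Type*} [NormedAddCommGroup V] [NormedSpace ℝ V] {H : V → Set V}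
    {γ : ℝ → V} (h : IsSolution H γ) (T : ℝ) :
    ∀ᵐ t ∂(volume.restrict (Icc 0 T)), ∃ v : V, HasDerivAt γ v t ∧ -v ∈ H (γ t) := by
  rw [ae_restrict_Icc_iff_Ioo]
  exact ae_restrict_of_ae_restrict_of_subset Ioo_subset_Ioi_self h.2

/-- The velocity always points towards `Y`. If a functional `φ` separated `y T` from `Y` at level
`c`, then `exp (k s) (φ (y s) - c)` would be nonincreasing, negative at `0` and positive at `T`. -/
theorem mem_of_relaxation {F : Type*} [NormedAddCommGroup F] [NormedSpace ℝ F]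
    {Y : Set F} (hYc : IsClosed Y) (hY : Convex ℝ Y) {y : ℝ → F} {T k : ℝ} (hT : 0 ≤ T)
    (hk : 0 ≤ k) (hy : AbsolutelyContinuousOnInterval y 0 T) (h0 : y 0 ∈ Y)
    (h : ∀ᵐ t ∂(volume.restrict (Icc 0 T)), ∃ p ∈ Y, HasDerivAt y (k • (p - y t)) t) :
    y T ∈ Y := by
  by_contra hcon
  obtain ⟨φ, c, h1, h2⟩ := geometric_hahn_banach_closed_point hY hYc hcon
  have hexp : AbsolutelyContinuousOnInterval (fun s : ℝ => Real.exp (k * s)) 0 T :=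
    (ContDiff.locallyLipschitz (𝕂 := ℝ) (f := fun s : ℝ => Real.exp (k * s))
      (by fun_prop)).comp_absolutelyContinuousOnInterval (γ := fun s => s)
      (LipschitzWith.id.lipschitzOnWith (s := uIcc 0 T)).absolutelyContinuousOnInterval
  have hφ : AbsolutelyContinuousOnInterval (fun s => φ (y s) - c) 0 T :=
    (ContDiff.locallyLipschitz (𝕂 := ℝ) (f := fun w : F => φ w - c)
      (by fun_prop)).comp_absolutelyContinuousOnInterval hy
  have hle := sub_le_of_ae_hasDerivAt_le hT (hexp.fun_mul hφ) (c := 0) ?_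
  · simp only [mul_zero, Real.exp_zero, one_mul, zero_mul] at hle
    have h3 := h1 _ h0
    have h4 : 0 < Real.exp (k * T) * (φ (y T) - c) :=
      mul_pos (Real.exp_pos _) (sub_pos.2 h2)
    linarith
  · filter_upwards [h] with t ht
    obtain ⟨p, hp, hd⟩ := ht
    have hd1 : HasDerivAt (fun s => φ (y s) - c) (φ (k • (p - y t))) t :=
      (φ.hasFDerivAt.comp_hasDerivAt t hd).sub_const c
    have hd2 : HasDerivAt (fun s : ℝ => Real.exp (k * s)) (Real.exp (k * t) * k) t := by
      simpa using ((hasDerivAt_id t).const_mul k).exp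
    refine ⟨_, hd2.fun_mul hd1, ?_⟩
    have e : Real.exp (k * t) * k * (φ (y t) - c) + Real.exp (k * t) * φ (k • (p - y t)) =
        Real.exp (k * t) * k * (φ p - c) := by
      rw [map_smul, map_sub, smul_eq_mul]
      ring
    rw [e]
    exact mul_nonpos_of_nonneg_of_nonpos (by positivity) (sub_nonpos.2 (h1 p hp).le)

variable {E F : Type*} [NormedAddCommGroup E] [InnerProductSpace ℝ E] [CompleteSpace E]
  [NormedAddCommGroup F] [InnerProductSpace ℝ F] [CompleteSpace F]

theorem IsProxMap.solution_mem {X : Set E} {Y : Set F} (hX : IsClosed X) (hYc : IsClosed Y)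
    (hY : Convex ℝ Y) {f : E → F → ℝ} {r₁ : E → ℝ} {r₂ : F → ℝ} {η θ : ℝ} (hη : 0 < η)
    (hθ : 0 ≤ θ) {P : F → F} (hP : IsProxMap Y r₂ η P) {γ : ℝ → E × F}
    (hγ : IsSolution (sgdaField X Y f r₁ r₂ η θ) γ) (h0 : γ 0 ∈ X ×ˢ Y) {t : ℝ} (ht : 0 ≤ t) :
    γ t ∈ X ×ˢ Y := by
  rcases ht.eq_or_lt with rfl | ht
  · exact h0
  have hac := hγ.1 t ht
  have hae := hγ.ae_Icc t
  constructor
  -- The normal cone is empty off `X`, so the inclusion itself forces `x ∈ X` at almost every time.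
  · have hcont : ContinuousOn γ (Icc 0 t) := by
      simpa [uIcc_of_le ht.le] using hac.continuousOn
    refine mem_of_ae_mem hX ht (γ := fun s => (γ s).1) (continuous_fst.comp_continuousOn hcont) ?_
      t (right_mem_Icc.2 ht.le)
    filter_upwards [hae] with s hs
    obtain ⟨v, -, ⟨-, -, ν, hν, -⟩, -⟩ := hs
    exact hν.1
  · refine mem_of_relaxation hYc hY (y := fun s => (γ s).2) ht.le (k := θ * η⁻¹)
      (mul_nonneg hθ (inv_pos.2 hη).le)
      (LipschitzWith.prod_snd.locallyLipschitz.comp_absolutelyContinuousOnInterval hac) h0.2 ?_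
    filter_upwards [hae] with s hs
    obtain ⟨v, hv, hmem⟩ := hs
    refine ⟨_, hP.mem ((γ s).2 + η • gradY f (γ s).1 (γ s).2), ?_⟩
    have h2 := ((hP.mem_sgdaField_iff hη _ _).1 hmem).2
    rw [Prod.snd_neg, neg_inj, smul_smul] at h2
    rw [← h2]
    exact hv.snd_prod

end Invariance

/-! ### The dissipation inequality and the strict decrease. -/

section Dissipation

variable {E F : Type*} [NormedAddCommGroup E] [InnerProductSpace ℝ E] [CompleteSpace E]
  [NormedAddCommGroup F] [InnerProductSpace ℝ F] [CompleteSpace F]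
  [FiniteDimensional ℝ F]

theorem dissipation_bound {L μ η α θ a b : ℝ} (hμ : 0 < μ) (hη : 0 < η)
    (hα₁ : 1 ≤ α) (hα₂ : 2 / (η * μ) ≤ α) (hθ : α * η * L ^ 2 / μ ≤ θ) :
    -a ^ 2 + α * η * (L * a * b - μ * θ * b ^ 2) + θ * b ^ 2 ≤
      -(1 / 4) * a ^ 2 - 1 / 6 * (α * η * μ * θ) * b ^ 2 := by
  have h1 : 2 ≤ α * η * μ := by
    rw [div_le_iff₀ (by positivity)] at hα₂
    linarith
  have h2 : α * η * L ^ 2 ≤ θ * μ := (div_le_iff₀ hμ).1 hθ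
  have hαη : 0 < α * η := by positivity
  have hθ0 : 0 ≤ θ := le_trans (by positivity) hθ
  have h3 : (α * η * L) ^ 2 ≤ α * η * μ * θ := by nlinarith
  have h4 : 2 * (θ * b ^ 2) ≤ α * η * μ * (θ * b ^ 2) :=
    mul_le_mul_of_nonneg_right h1 (by positivity)
  have h5 : (α * η * L) ^ 2 * b ^ 2 ≤ α * η * μ * θ * b ^ 2 :=
    mul_le_mul_of_nonneg_right h3 (sq_nonneg b)
  -- With `c = αηLb` and `Q = αημθb²`, one has `θb² ≤ Q/2` and `c² ≤ Q`. What remains is `3a²/4 - ca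
  -- + c²/3 = (3a/2 - c)²/3 ≥ 0`.
  nlinarith [sq_nonneg (3 / 2 * a - α * η * L * b)]

/-- At almost every time the penalty function decreases along a solution, at a rate controlled by
the speed in the first variable and the proximal residual. -/
theorem IsProxMap.ae_dissipation {X : Set E} {Y : Set F} (hX : IsClosed X) (hYc : IsClosed Y)
    (hY : Convex ℝ Y) {f : E → F → ℝ} {r₁ : E → ℝ} {r₂ : F → ℝ} {L : NNReal} {μ η α θ : ℝ}
    (hf : ContDiff ℝ 1 fun z : E × F => f z.1 z.2)
    (hL : ∀ x y x' y', ‖gradX f x y - gradX f x' y'‖ ^ 2 + ‖gradY f x y - gradY f x' y'‖ ^ 2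
      ≤ (L : ℝ) ^ 2 * (‖x - x'‖ ^ 2 + ‖y - y'‖ ^ 2))
    (hμ : 0 < μ) (hconc : ∀ x ∈ X, StrongConcaveOn Y μ (f x))
    (hchain : ∀ (a b : ℝ) (x : ℝ → E), a < b → AbsolutelyContinuousOnInterval x a b →
      ∀ᵐ t ∂(volume.restrict (Icc a b)), ∃ v : E, HasDerivAt x v t ∧
        ∀ d ∈ clarkeSubdiff r₁ (x t), HasDerivAt (fun s => r₁ (x s)) (inner ℝ d v) t)
    (hr₂Lip : LocallyLipschitz r₂) (hr₂ : ConvexOn ℝ univ r₂)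
    (hη : 0 < η) (hα : max 1 (2 / (η * μ)) ≤ α) (hθ : α * η * (L : ℝ) ^ 2 / μ ≤ θ)
    {P : F → F} (hP : IsProxMap Y r₂ η P) {γ : ℝ → E × F}
    (hγ : IsSolution (sgdaField X Y f r₁ r₂ η θ) γ) (h0 : γ 0 ∈ X ×ˢ Y) {T : ℝ} (hT : 0 < T) :
    ∀ᵐ t ∂(volume.restrict (Icc 0 T)), ∃ v D, HasDerivAt γ v t ∧
      -v ∈ sgdaField X Y f r₁ r₂ η θ (γ t) ∧
      HasDerivAt (fun s => penalty Y f r₁ r₂ η α (γ s)) D t ∧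
      D ≤ -(1 / 4) * ‖v.1‖ ^ 2 - 1 / 6 * (α * η * μ * θ) *
        ‖η⁻¹ • (P ((γ t).2 + η • gradY f (γ t).1 (γ t).2) - (γ t).2)‖ ^ 2 := by
  have hα₁ : 1 ≤ α := (le_max_left _ _).trans hα
  have hα₂ : 2 / (η * μ) ≤ α := (le_max_right _ _).trans hα
  have hα0 : 0 < α := one_pos.trans_le hα₁
  have hθ0 : 0 ≤ θ := le_trans (by positivity) hθ
  have hac := hγ.1 T hT
  have hfd : Differentiable ℝ fun z : E × F => f z.1 z.2 := hf.differentiable one_ne_zero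
  have hgl : LocallyLipschitz fun z : E × F => gradY f z.1 z.2 :=
    (lipschitzWith_gradY hL).locallyLipschitz
  have hxac := LipschitzWith.prod_fst.locallyLipschitz.comp_absolutelyContinuousOnInterval hac
  have hyac := LipschitzWith.prod_snd.locallyLipschitz.comp_absolutelyContinuousOnInterval hac
  have hg := ae_exists_hasDerivAt hT.le (hgl.comp_absolutelyContinuousOnInterval hac)
  have he := ae_exists_hasDerivAt hT.le ((hP.locallyLipschitz_envelope hη (hf.locallyLipschitz)
    hgl hr₂Lip).comp_absolutelyContinuousOnInterval hac)
  have hr := ae_exists_hasDerivAt hT.le (hr₂Lip.comp_absolutelyContinuousOnInterval hyac)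
  have hae := hγ.ae_Icc T
  have hch := hchain 0 T _ hT hxac
  -- Interior times have a two-sided neighbourhood in `[0, ∞)`, which the orthogonality of `ν` and
  -- `x'` needs.
  rw [ae_restrict_Icc_iff_Ioo] at hg he hr hae hch ⊢
  filter_upwards [hg, he, hr, hae, hch, ae_restrict_mem measurableSet_Ioo]
    with t hgt het hrt hvt hct htT
  obtain ⟨g', hg'⟩ := hgt
  obtain ⟨e', he'⟩ := het
  obtain ⟨ρ, hρ⟩ := hrt
  obtain ⟨v, hv, hmem⟩ := hvt
  obtain ⟨v₁, hv₁, hch⟩ := hct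
  obtain rfl := hv₁.unique hv.fst_prod
  have hS : ∀ s, 0 ≤ s → γ s ∈ X ×ˢ Y := fun s hs =>
    hP.solution_mem hX hYc hY hη hθ0 hγ h0 hs
  obtain ⟨⟨l, hl, ν, hν, -, hw1⟩, hw2⟩ := (hP.mem_sgdaField_iff hη _ _).1 hmem
  set R := η⁻¹ • (P ((γ t).2 + η • gradY f (γ t).1 (γ t).2) - (γ t).2) with hR
  have hTR : P ((γ t).2 + η • gradY f (γ t).1 (γ t).2) - (γ t).2 = η • R := by
    rw [hR, smul_smul, mul_inv_cancel₀ hη.ne', one_smul]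
  clear_value R
  have hv2 : v.2 = θ • R := by simpa using hw2
  have hst := hS t htT.1.le
  have hTeq : P ((γ t).2 + η • gradY f (γ t).1 (γ t).2) = (γ t).2 + η • R := by
    rw [← hTR]
    abel
  have hyR : (γ t).2 + η • R ∈ Y := hTeq ▸ hP.mem _
  have hcurv := inner_deriv_gradY_le hL hfd hY hμ.le hv (hconc _ hst.1) hη hθ0 hst.2 hyR hv2 hg'
  have henv := hP.deriv_envelope_eq hη hfd hv hg' he' hTR
  have hfder := hasDerivAt_comp_uncurried hfd hv
  have hν0 : inner ℝ ν v.1 = 0 := by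
    refine inner_deriv_eq_zero_of_mem_normalCone hv.fst_prod ?_ hν
    filter_upwards [Ioi_mem_nhds htT.1] with s hs using (hS s (le_of_lt hs)).1
  have hA : inner ℝ (gradX f (γ t).1 (γ t).2) v.1 + inner ℝ l v.1 = -‖v.1‖ ^ 2 := by
    have h1 : l + gradX f (γ t).1 (γ t).2 + ν = -v.1 := by rw [← hw1, Prod.fst_neg]
    have h2 : inner ℝ (l + gradX f (γ t).1 (γ t).2 + ν) v.1 = -‖v.1‖ ^ 2 := by
      rw [h1, inner_neg_left, real_inner_self_eq_norm_sq]
    rw [inner_add_left, inner_add_left, hν0] at h2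
    linarith
  obtain ⟨d, hd⟩ := (isClosedField_limitingGradients hr₂Lip).nonempty (γ t).2
  have hdsub := inner_sub_le_of_mem_limitingGradients hr₂ hr₂Lip.continuous hd
  have hρd := hasDerivAt_eq_inner_of_subgradient hv.snd_prod hρ hdsub
  -- Adding the subgradient inequality at `y` tested at `T` to the proximal inequality at `T` tested
  -- at `y` cancels the values of `r₂`.
  have hdR : inner ℝ d R ≤ inner ℝ (gradY f (γ t).1 (γ t).2) R - ‖R‖ ^ 2 := by
    have h1 := hdsub ((γ t).2 + η • R)
    have h2 := hP.le ((γ t).2 + η • gradY f (γ t).1 (γ t).2) _ hst.2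
    rw [hTeq] at h2
    have h3 : (γ t).2 + η • gradY f (γ t).1 (γ t).2 - ((γ t).2 + η • R) =
        η • (gradY f (γ t).1 (γ t).2 - R) := by module
    have h4 : (γ t).2 - ((γ t).2 + η • R) = -(η • R) := by abel
    rw [h3, h4, smul_smul, inv_mul_cancel₀ hη.ne', one_smul, inner_neg_right, inner_smul_right,
      inner_sub_left, real_inner_self_eq_norm_sq] at h2
    rw [add_sub_cancel_left, inner_smul_right] at h1
    refine le_of_mul_le_mul_left ?_ hη
    linarith
  have hD := ((he'.const_mul α).fun_sub (hfder.const_mul (α - 1))).fun_add (hch l hl) |>.fun_add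
    (hρ.const_mul (α - 1))
  refine ⟨v, _, hv, hmem, hD, ?_⟩
  refine le_trans ?_ (dissipation_bound (a := ‖v.1‖) (b := ‖R‖) hμ hη hα₁ hα₂ hθ)
  rw [henv, hρd, hv2, inner_smul_right, inner_smul_right, inner_smul_right,
    real_inner_self_eq_norm_sq]
  have h1 := mul_le_mul_of_nonneg_left hcurv (mul_nonneg hα0.le hη.le)
  have h2 := mul_le_mul_of_nonneg_left hdR (mul_nonneg (sub_nonneg.2 hα₁) hθ0)
  linarith

variable [FiniteDimensional ℝ E]

theorem IsProxMap.isLyapunovFunction {X : Set E} {Y : Set F} (hX : IsClosed X)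
    (hYc : IsClosed Y) (hY : Convex ℝ Y) {f : E → F → ℝ} {r₁ : E → ℝ} {r₂ : F → ℝ} {L : NNReal}
    {μ η α θ : ℝ} (hf : ContDiff ℝ 1 fun z : E × F => f z.1 z.2)
    (hL : ∀ x y x' y', ‖gradX f x y - gradX f x' y'‖ ^ 2 + ‖gradY f x y - gradY f x' y'‖ ^ 2
      ≤ (L : ℝ) ^ 2 * (‖x - x'‖ ^ 2 + ‖y - y'‖ ^ 2))
    (hμ : 0 < μ) (hconc : ∀ x ∈ X, StrongConcaveOn Y μ (f x))
    (hr₁ : PathDifferentiable r₁) (hr₂Lip : LocallyLipschitz r₂) (hr₂ : ConvexOn ℝ univ r₂)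
    (hη : 0 < η) (hα : max 1 (2 / (η * μ)) ≤ α) (hθ : α * η * (L : ℝ) ^ 2 / μ ≤ θ)
    {P : F → F} (hP : IsProxMap Y r₂ η P) :
    IsLyapunovFunction (X ×ˢ Y) (sgdaField X Y f r₁ r₂ η θ)
      (firstOrderMinimaxPoints X Y f r₁ r₂) (penalty Y f r₁ r₂ η α) := by
  obtain ⟨hr₁Lip, D₁, hD₁⟩ := hr₁
  have hα0 : 0 < α := one_pos.trans_le ((le_max_left _ _).trans hα)
  have hθ0 : 0 ≤ θ := le_trans (by positivity) hθ
  have hfd : Differentiable ℝ fun z : E × F => f z.1 z.2 := hf.differentiable one_ne_zero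
  have hgl := (lipschitzWith_gradY hL).locallyLipschitz
  have hΓ := locallyLipschitz_penalty α (hP.locallyLipschitz_envelope hη hf.locallyLipschitz hgl
    hr₂Lip) hf.locallyLipschitz hr₁Lip hr₂Lip
  have hdiss := fun {γ : ℝ → E × F} (hγ : IsSolution (sgdaField X Y f r₁ r₂ η θ) γ)
    (h0 : γ 0 ∈ X ×ˢ Y) {T : ℝ} (hT : 0 < T) =>
    hP.ae_dissipation hX hYc hY hf hL hμ hconc
      (fun a b x hab hx => hD₁.chainRule_clarkeSubdiff hr₁Lip hab hx) hr₂Lip hr₂ hη hα hθ hγ h0 hT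
  have hsub : firstOrderMinimaxPoints X Y f r₁ r₂ ⊆ X ×ˢ Y := fun z hz => ⟨hz.1, hz.2.1⟩
  have hneg : ∀ a b : ℝ, -(1 / 4) * a ^ 2 - 1 / 6 * (α * η * μ * θ) * b ^ 2 ≤ 0 := by
    intro a b
    have h1 : 0 ≤ 1 / 6 * (α * η * μ * θ) * b ^ 2 := by positivity
    have h2 := sq_nonneg a
    linarith
  refine ⟨hsub, isClosed_firstOrderMinimaxPoints hX hYc (lipschitzWith_gradX hL).continuous
    hgl.continuous hr₁Lip hr₂Lip, hΓ.continuous, ?_, ?_⟩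
  · intro γ hγ h0 hA t ht
    by_contra! hle
    refine hA ?_
    have hac := hγ.1 t ht
    have hd := hdiss hγ h0 ht
    have hzero := ae_deriv_eq_zero_of_nonpos ht.le (hΓ.comp_absolutelyContinuousOnInterval hac) (by
      filter_upwards [hd] with s hs
      obtain ⟨v, D, -, -, hD, hDle⟩ := hs
      rw [hD.deriv]
      exact hDle.trans (hneg _ _)) hle
    have hrest : ∀ᵐ s ∂(volume.restrict (Icc 0 t)), HasDerivAt γ 0 s ∧
        0 ∈ sgdaField X Y f r₁ r₂ η θ (γ s) ∧
        (0 < θ → P ((γ s).2 + η • gradY f (γ s).1 (γ s).2) = (γ s).2) := by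
      filter_upwards [hd, hzero] with s hs hs0
      obtain ⟨v, D, hv, hmem, hD, hDle⟩ := hs
      rw [hD.deriv] at hs0
      rw [hs0] at hDle
      set R := η⁻¹ • (P ((γ s).2 + η • gradY f (γ s).1 (γ s).2) - (γ s).2) with hR
      have h1 : 0 ≤ 1 / 6 * (α * η * μ * θ) * ‖R‖ ^ 2 := by positivity
      have h2 : v.1 = 0 := by
        have h3 : ‖v.1‖ ^ 2 = 0 := le_antisymm (by linarith) (sq_nonneg _)
        exact norm_eq_zero.1 (pow_eq_zero_iff two_ne_zero |>.1 h3)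
      have h3 : 0 < θ → R = 0 := by
        intro hθp
        by_contra hRne
        have h4 : 0 < ‖R‖ := norm_pos_iff.2 hRne
        have h5 : 0 < 1 / 6 * (α * η * μ * θ) * ‖R‖ ^ 2 := by positivity
        linarith [sq_nonneg ‖v.1‖]
      have h4 : v.2 = θ • R := by
        simpa using ((hP.mem_sgdaField_iff hη _ _).1 hmem).2
      have h5 : v = 0 := by
        refine Prod.ext h2 ?_
        rw [h4]
        rcases hθ0.eq_or_lt with h | h
        · rw [← h, zero_smul, Prod.snd_zero]
        · rw [h3 h, smul_zero, Prod.snd_zero]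
      rw [h5] at hv hmem
      rw [neg_zero] at hmem
      refine ⟨hv, hmem, fun h => ?_⟩
      exact sub_eq_zero.1 ((smul_eq_zero.1 (h3 h)).resolve_left (inv_pos.2 hη).ne')
    obtain ⟨C, hC⟩ := hac.const_of_ae_hasDerivAt_zero (by
      rw [uIcc_of_le ht.le, ← ae_restrict_iff' measurableSet_Icc]
      filter_upwards [hrest] with s hs using hs.1)
    rw [uIcc_of_le ht.le] at hC
    have hne : (ae (volume.restrict (Icc 0 t))).NeBot := by
      rw [ae_neBot, Ne, Measure.restrict_eq_zero, Real.volume_Icc, sub_zero,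
        ENNReal.ofReal_eq_zero, not_le]
      exact ht
    obtain ⟨s, ⟨-, hmem, hRs⟩, hs⟩ := (hrest.and (ae_restrict_mem measurableSet_Icc)).exists
    have hγs : γ s = γ 0 := (hC s hs).trans (hC 0 (left_mem_Icc.2 ht.le)).symm
    rw [hγs] at hmem hRs
    obtain ⟨⟨l, hl, ν, hν, -, hw⟩, -⟩ := (hP.mem_sgdaField_iff hη _ _).1 hmem
    refine hP.mem_firstOrderMinimaxPoints hY hr₂Lip hr₂ hη h0 ⟨l, hl, ν, hν, ?_⟩ ?_
    · rw [Prod.fst_zero] at hw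
      rw [hw]
      abel
    · rcases hθ0.eq_or_lt with h | h
      -- When `θ = 0` the dissipation says nothing about `R`. But then `L = 0`, so `∇_y f` is
      -- constant, and strong concavity on `Y` forces `p = y`.
      · have hL0 : (L : ℝ) ^ 2 = 0 := by
          rw [← h] at hθ
          have h1 : 0 < α * η / μ := by positivity
          have h2 : α * η * (L : ℝ) ^ 2 / μ = α * η / μ * (L : ℝ) ^ 2 := by ring
          rw [h2] at hθ
          by_contra hne
          have h3 : 0 < (L : ℝ) ^ 2 := lt_of_le_of_ne (sq_nonneg _) (Ne.symm hne)
          exact absurd hθ (not_le.2 (mul_pos h1 h3))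
        set p := P ((γ 0).2 + η • gradY f (γ 0).1 (γ 0).2) with hp
        have hpY : p ∈ Y := hP.mem _
        have hmono := inner_gradY_add_smul_sub_le hfd hμ.le (hconc _ h0.1) zero_le_one h0.2
          (R := p - (γ 0).2) (by rwa [one_smul, add_sub_cancel])
        rw [one_smul, add_sub_cancel] at hmono
        have hz : gradY f (γ 0).1 p - gradY f (γ 0).1 (γ 0).2 = 0 := by
          have h1 := hL (γ 0).1 p (γ 0).1 (γ 0).2
          rw [hL0, zero_mul] at h1
          have h2 := sq_nonneg ‖gradX f (γ 0).1 p - gradX f (γ 0).1 (γ 0).2‖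
          have h3 : ‖gradY f (γ 0).1 p - gradY f (γ 0).1 (γ 0).2‖ ^ 2 = 0 :=
            le_antisymm (by linarith) (sq_nonneg _)
          exact norm_eq_zero.1 (pow_eq_zero_iff two_ne_zero |>.1 h3)
        rw [hz, inner_zero_left] at hmono
        have h3 : ‖p - (γ 0).2‖ ^ 2 = 0 := by
          refine le_antisymm ?_ (sq_nonneg _)
          by_contra! hpos
          have := mul_pos hμ hpos
          linarith
        exact sub_eq_zero.1 (norm_eq_zero.1 (pow_eq_zero_iff two_ne_zero |>.1 h3))
      · exact hRs h
  · intro γ hγ hA t ht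
    rcases ht.eq_or_lt with rfl | ht
    · exact le_rfl
    have hle := sub_le_of_ae_hasDerivAt_le ht.le (c := 0)
      (hΓ.comp_absolutelyContinuousOnInterval (hγ.1 t ht)) (by
        filter_upwards [hdiss hγ (hsub hA) ht] with s hs
        obtain ⟨v, D, -, -, hD, hDle⟩ := hs
        exact ⟨D, hD, hDle.trans (hneg _ _)⟩)
    linarith

end Dissipation

end MinimaxFlow

theorem mainTheorem6 {n p : ℕ}
    (X : Set (EuclideanSpace ℝ (Fin n))) (Y : Set (EuclideanSpace ℝ (Fin p)))
    (f : EuclideanSpace ℝ (Fin n) → EuclideanSpace ℝ (Fin p) → ℝ)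
    (r₁ : EuclideanSpace ℝ (Fin n) → ℝ) (r₂ : EuclideanSpace ℝ (Fin p) → ℝ)
    (L : NNReal) (μ η α θ : ℝ) (ηx ηy : ℕ → ℝ)
    -- the constraint sets
    (hXclosed : IsClosed X) (hXconvex : Convex ℝ X)
    (hYclosed : IsClosed Y) (hYconvex : Convex ℝ Y)
    -- `f` is continuously differentiable and its gradient is `L`-Lipschitz (Euclidean norms)
    (hf : ContDiff ℝ 1
      (fun z : EuclideanSpace ℝ (Fin n) × EuclideanSpace ℝ (Fin p) => f z.1 z.2))
    (hfLip : ∀ x y x' y',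
      ‖MinimaxFlow.gradX f x y - MinimaxFlow.gradX f x' y'‖ ^ 2
          + ‖MinimaxFlow.gradY f x y - MinimaxFlow.gradY f x' y'‖ ^ 2
        ≤ (L : ℝ) ^ 2 * (‖x - x'‖ ^ 2 + ‖y - y'‖ ^ 2))
    -- the partial Hessian in `y` exists on `X × Y`
    (hfyy : ∀ x ∈ X, ∀ y ∈ Y,
      DifferentiableAt ℝ (fun y' => MinimaxFlow.gradY f x y') y)
    -- uniform strong concavity in `y`
    (hμ : 0 < μ) (hconc : ∀ x ∈ X, StrongConcaveOn Y μ (fun y => f x y))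
    -- the nonsmooth terms
    (hr₁Lip : LocallyLipschitz r₁) (hr₁ : MinimaxFlow.PathDifferentiable r₁)
    (hr₂Lip : LocallyLipschitz r₂) (hr₂ : ConvexOn ℝ univ r₂)
    -- finitely many values at first-order minimax points
    (hSard : (MinimaxFlow.objective f r₁ r₂ ''
      MinimaxFlow.firstOrderMinimaxPoints X Y f r₁ r₂).Finite)
    -- the parameters and the stepsizes
    (hη : 0 < η) (hα : max 1 (2 / (η * μ)) ≤ α)
    (hηx : ∀ k, 0 < ηx k) (hηy : ∀ k, 0 < ηy k) (hηyle : ∀ k, ηy k ≤ η)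
    (hηxsum : Tendsto (fun N => ∑ k ∈ Finset.range N, ηx k) atTop atTop)
    (hηysum : Tendsto (fun N => ∑ k ∈ Finset.range N, ηy k) atTop atTop)
    (hθ : α * η * (L : ℝ) ^ 2 / μ ≤ θ)
    (hratio : Tendsto (fun k => ηy k / ηx k) atTop (𝓝 θ))
    -- coercivity of the penalty function over `X × Y`
    (hcoer : ∀ α' : ℝ, max 1 (2 / (η * μ)) ≤ α' →
      Tendsto (MinimaxFlow.penalty Y f r₁ r₂ η α')
        (Bornology.cobounded _ ⊓ 𝓟 (X ×ˢ Y)) atTop) :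
    MinimaxFlow.IsAdmissibleField (X ×ˢ Y) (MinimaxFlow.sgdaField X Y f r₁ r₂ η θ) ∧
    MinimaxFlow.IsLyapunovFunction (X ×ˢ Y) (MinimaxFlow.sgdaField X Y f r₁ r₂ η θ)
      (MinimaxFlow.firstOrderMinimaxPoints X Y f r₁ r₂)
      (MinimaxFlow.penalty Y f r₁ r₂ η α) := by
  have hgX := (MinimaxFlow.lipschitzWith_gradX hfLip).continuous
  have hgY := (MinimaxFlow.lipschitzWith_gradY hfLip).continuous
  rcases Y.eq_empty_or_nonempty with rfl | hne
  -- No proximal map exists when `Y` is empty. The envelope is then the default value `sSup ∅ = 0`,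
  -- and only global continuity of the penalty and closedness of the stable set have content.
  · have hS : X ×ˢ (∅ : Set (EuclideanSpace ℝ (Fin p))) = ∅ := prod_empty
    have he : LocallyLipschitz fun z : EuclideanSpace ℝ (Fin n) × EuclideanSpace ℝ (Fin p) =>
        MinimaxFlow.envelope ∅ f r₂ η z.1 z.2 := by
      simp only [MinimaxFlow.envelope, image_empty, Real.sSup_empty]
      exact LocallyLipschitz.const 0
    rw [hS]
    refine ⟨⟨fun z hz => hz.elim, fun z hz => hz.elim, fun z hz => hz.elim, by simp⟩,
      fun z hz => hz.2.1.elim, MinimaxFlow.isClosed_firstOrderMinimaxPoints hXclosed hYclosed hgX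
        hgY hr₁Lip hr₂Lip, ?_, fun γ _ h0 => h0.elim, fun γ _ h0 => h0.2.1.elim⟩
    exact (MinimaxFlow.locallyLipschitz_penalty α he hf.locallyLipschitz hr₁Lip
      hr₂Lip).continuous
  · obtain ⟨P, hP⟩ := MinimaxFlow.exists_isProxMap hne hYclosed hYconvex hr₂Lip hr₂ hη
    exact ⟨hP.isAdmissibleField hXclosed hYclosed hgX hgY hr₁Lip θ hη,
      hP.isLyapunovFunction hXclosed hYclosed hYconvex hf hfLip hμ hconc hr₁ hr₂Lip hr₂ hη hα hθ⟩
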